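/- Let $n\ge 2$ be an integer, let $q$ be a prime power, and let $M_n(q)$ be the ring of all $n\times n$ matrices over the field $\mathbb F_q$ with $q$ elements. Let $b$ be the smallest prime divisor of $n$, and let $N(b)$ be the number of subspaces of $\mathbb F_q^n$ whose dimension is not divisible by $b$ and is at most $n/2$. Here a subring of a ring is a subset that contains $0$ and is closed under subtraction and multiplication; it need not contain the multiplicative identity. Then $M_n(q)$ is the union of finitely many proper subrings, and the minimal number $\sigma(M_n(q))$ of proper subrings of $M_n(q)$ whose union is $M_n(q)$ is $$\sigma(M_n(q))=\frac1b\prod_{\substack{1\le i\le n-1\\ b\nmid i}}\left(q^n-q^i\right)+N(b).$$ -/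

import Mathlib

/-- A finite set `C` of subrings of `R` is a proper cover if all its members are proper and their
union is `R`. Subrings are not required to contain a multiplicative identity. -/
def IsProperSubringCover {R : Type*} [NonUnitalRing R] (C : Finset (NonUnitalSubring R)) : Prop :=
  (∀ S ∈ C, S ≠ ⊤) ∧ ∀ x : R, ∃ S ∈ C, x ∈ S

/-- `R` is the union of finitely many proper subrings. -/
def IsProperlyCoverable (R : Type*) [NonUnitalRing R] : Prop :=
  ∃ C : Finset (NonUnitalSubring R), IsProperSubringCover C

/-- `σ(R)`: the minimal number of proper subrings of `R` whose union is `R`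
(meaningful when `R` is the union of finitely many proper subrings). -/
noncomputable def coveringNumber (R : Type*) [NonUnitalRing R] : ℕ :=
  sInf {k : ℕ | ∃ C : Finset (NonUnitalSubring R), IsProperSubringCover C ∧ C.card = k}

/-- The number of subspaces of `F ^ n` whose dimension is not divisible by `b` and is at most
`n / 2`. -/
noncomputable def numSubspaces (F : Type*) [Field F] (n b : ℕ) : ℕ :=
  Set.ncard {U : Submodule F (Fin n → F) |
    ¬ b ∣ Module.finrank F U ∧ (Module.finrank F U : ℚ) ≤ (n : ℚ) / 2}

/-!
Write `Φ d` for the number of embeddings of the extension of `F` of degree `d` into `End V`, where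
`n = dim V`, and let `T` be the set of subspaces of dimension at most `n / 2` not divisible by `b`.
The claim is `b * σ (End V) = Φ b + b * #T`.

*Upper bound.* The stabilizers of the `U ∈ T` together with the centralizers of the embedded fields
of degree `b` cover `End V`: if the commutative algebra `F[x]` has no invariant subspace in `T`,
then `b` divides the degrees of all its residue fields, so it contains a field of degree `b`. Each
such field is the image of `b` embeddings, by Galois theory.

*Lower bound.* This is a weighted count over conjugates of well-chosen elements: a generator `y` of
a field of degree `n` and, for each `k ≤ n / 2` not divisible by `b`, an element `x k` whose only
invariant subspaces are `0`, `V`, one of dimension `k` and possibly one of dimension `n - k`. By the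
double centralizer and Wedderburn theorems, a proper subring `S` containing one of them is
contained in the stabilizer of a subspace or in the centralizer of a field of prime degree, and
hence `Φ b * #{g | g y g⁻¹ ∈ S} + b * ∑_{U ∈ T} #{g | g (x (dim U)) g⁻¹ ∈ S} ≤ b * #GL(V)`.
Summing over the members of a cover gives the bound.
-/

open Module Pointwise

/-! ### Subalgebras of an endomorphism algebra -/

section Subalgebra

variable {F V : Type*} [Field F] [AddCommGroup V] [Module F V] [Nontrivial V]

theorem isSimpleModule_of_forall_invtSubmodule {S : Subalgebra F (End F V)}
    (hS : ∀ U : Submodule F V, (∀ a ∈ S, U ∈ End.invtSubmodule a) → U = ⊥ ∨ U = ⊤) :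
    IsSimpleModule S V where
  eq_bot_or_eq_top W := by
    simpa using hS (W.restrictScalars F) fun a ha u hu => W.smul_mem ⟨a, ha⟩ hu

/-- Forgetting the linearity over a subalgebra `S` of `End F V`, as a map of `F`-algebras. -/
def endSubalgebraToEnd (S : Subalgebra F (End F V)) : End S V →ₐ[F] End F V where
  toFun f := f.restrictScalars F
  map_one' := rfl
  map_mul' _ _ := rfl
  map_zero' := rfl
  map_add' _ _ := rfl
  commutes' _ := rfl

variable [FiniteDimensional F V]

theorem eq_top_of_finrank_end_eq_one {S : Subalgebra F (End F V)} [IsSimpleModule S V]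
    (h : finrank F (End S V) = 1) : S = ⊤ := by
  have scalar (d : End S V) : ∃ r : F, r • (1 : End S V) = d :=
    (finrank_eq_one_iff_of_nonzero' _ one_ne_zero).1 h d
  refine eq_top_iff.2 fun f _ => ?_
  let f' : End (End S V) V :=
    { f with
      map_smul' := fun d v => by
        obtain ⟨r, rfl⟩ := scalar d
        exact f.map_smul r v }
  have : Module.Finite (End S V) V := Module.Finite.of_restrictScalars_finite F _ _
  obtain ⟨a, ha⟩ := Module.Finite.toModuleEnd_moduleEnd_surjective (R := S) (M := V) f'
  have haf : (a : End F V) = f := LinearMap.ext fun v => DFunLike.congr_fun ha v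
  exact haf ▸ a.2

end Subalgebra

theorem exists_field_finrank_eq (F : Type*) [Field F] [Finite F] {d : ℕ} (hd : d ≠ 0) :
    ∃ (K : Type) (_ : Field K) (_ : Algebra F K), FiniteDimensional F K ∧ finrank F K = d := by
  have : NeZero d := ⟨hd⟩
  have : Fact (ringChar F).Prime := ⟨CharP.char_is_prime F (ringChar F)⟩
  exact ⟨FiniteField.Extension F (ringChar F) d, inferInstance, inferInstance, inferInstance,
    FiniteField.finrank_extension ..⟩

open Classical in
/-- The commutant of a simple subalgebra is a finite field by Schur and Wedderburn; if it is `F`,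
the double centralizer theorem makes the subalgebra the whole endomorphism algebra. -/
theorem exists_invtSubmodule_or_exists_commute {F V : Type*} [Field F] [Finite F]
    [AddCommGroup V] [Module F V] [Finite V] [Nontrivial V] {S : Subalgebra F (End F V)}
    (hS : S ≠ ⊤) :
    (∃ U : Submodule F V, U ≠ ⊥ ∧ U ≠ ⊤ ∧ ∀ a ∈ S, U ∈ End.invtSubmodule a) ∨
    ∃ (K : Type) (_ : Field K) (_ : Algebra F K) (φ : K →ₐ[F] End F V),
      (finrank F K).Prime ∧ ∀ a ∈ S, ∀ k, Commute (φ k) a := by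
  refine or_iff_not_imp_left.2 fun hinv => ?_
  have : IsSimpleModule S V := isSimpleModule_of_forall_invtSubmodule fun U hU => by
    by_contra! h
    exact hinv ⟨U, h.1, h.2, hU⟩
  have : Finite (End S V) := DFunLike.finite _
  let _ : Field (End S V) := littleWedderburn (End S V)
  obtain ⟨p, hp, hpd⟩ := Nat.exists_prime_and_dvd fun h1 => hS (eq_top_of_finrank_end_eq_one h1)
  obtain ⟨K, _, _, _, rfl⟩ := exists_field_finrank_eq F hp.ne_zero
  obtain ⟨ψ⟩ := FiniteField.nonempty_algHom_of_finrank_dvd hpd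
  exact ⟨K, _, _, (endSubalgebraToEnd S).comp ψ, hp, fun a ha k =>
    LinearMap.ext fun v => (ψ k).map_smul (⟨a, ha⟩ : S) v⟩

/-! ### Counting conjugates -/

theorem card_smul_eq_mul_card_orbit {G X : Type*} [Group G] [MulAction G X] {x y : X}
    (hy : y ∈ MulAction.orbit G x) :
    Nat.card {g : G // g • x = y} * Nat.card (MulAction.orbit G x) = Nat.card G := by
  obtain ⟨h, rfl⟩ := hy
  rw [← (MulAction.stabilizer G x).card_mul_index, MulAction.index_stabilizer]
  refine congrArg (· * _) (Nat.card_congr ((Equiv.mulLeft h⁻¹).subtypeEquiv fun g => ?_))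
  rw [Equiv.coe_mulLeft, MulAction.mem_stabilizer_iff, mul_smul, inv_smul_eq_iff]

section

variable {F V : Type*} [Field F] [AddCommGroup V] [Module F V]

instance [Finite V] : Finite (V ≃ₗ[F] V) := DFunLike.finite _

instance [Finite V] : Finite (End F V) := DFunLike.finite _

theorem exists_smul_eq_of_finrank_eq [FiniteDimensional F V] {U W : Submodule F V}
    (h : finrank F U = finrank F W) : ∃ g : V ≃ₗ[F] V, g • U = W := by
  obtain ⟨U', hU⟩ := U.exists_isCompl
  obtain ⟨W', hW⟩ := W.exists_isCompl
  have h' : finrank F U' = finrank F W' := by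
    have hU_add := Submodule.finrank_add_eq_of_isCompl hU
    have hW_add := Submodule.finrank_add_eq_of_isCompl hW
    lia
  let e := LinearEquiv.ofFinrankEq U W h
  let e' := LinearEquiv.ofFinrankEq U' W' h'
  let g : V ≃ₗ[F] V := (U.prodEquivOfIsCompl U' hU).symm ≪≫ₗ (e.prodCongr e') ≪≫ₗ
    (W.prodEquivOfIsCompl W' hW)
  have hle : g • U ≤ W := by
    rintro _ ⟨u, hu, rfl⟩
    have : (U.prodEquivOfIsCompl U' hU).symm u = (⟨u, hu⟩, 0) :=
      Submodule.prodEquivOfIsCompl_symm_apply_left U U' hU ⟨u, hu⟩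
    simp [g, this]
  exact ⟨g, Submodule.eq_of_le_of_finrank_eq hle (h ▸ LinearEquiv.finrank_map_eq g U)⟩

theorem orbit_submodule_eq [FiniteDimensional F V] (U : Submodule F V) :
    MulAction.orbit (V ≃ₗ[F] V) U = {W : Submodule F V | finrank F W = finrank F U} := by
  ext W
  constructor
  · rintro ⟨g, rfl⟩
    exact LinearEquiv.finrank_map_eq g U
  · exact fun h => exists_smul_eq_of_finrank_eq h.symm

theorem card_smul_submodule_eq_mul [FiniteDimensional F V] {U W : Submodule F V}
    (h : finrank F U = finrank F W) :
    Nat.card {g : V ≃ₗ[F] V // g • U = W} *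
      Nat.card {X : Submodule F V // finrank F X = finrank F U} = Nat.card (V ≃ₗ[F] V) := by
  have hW : W ∈ MulAction.orbit (V ≃ₗ[F] V) U := orbit_submodule_eq U ▸ h.symm
  rw [← card_smul_eq_mul_card_orbit hW, orbit_submodule_eq]
  rfl

theorem card_submodule_finrank_eq_of_add_eq [FiniteDimensional F V] {k l : ℕ}
    (h : k + l = finrank F V) :
    Nat.card {X : Submodule F V // finrank F X = k} =
      Nat.card {X : Submodule F V // finrank F X = l} := by
  let e : Dual F V ≃ₗ[F] V := LinearEquiv.ofFinrankEq _ _ Subspace.dual_finrank_eq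
  refine Nat.card_congr (((Subspace.orderIsoFiniteDimensional (K := F) (V := V)).toEquiv.trans
    (OrderDual.ofDual.trans (Submodule.orderIsoMapComap e).toEquiv)).subtypeEquiv fun X => ?_)
  have hX := Subspace.finrank_add_finrank_dualAnnihilator_eq X
  have hmap : finrank F (X.dualAnnihilator.map (e : Dual F V →ₗ[F] V)) =
      finrank F X.dualAnnihilator := LinearEquiv.finrank_map_eq e _
  change _ ↔ finrank F (X.dualAnnihilator.map (e : Dual F V →ₗ[F] V)) = l
  lia

end

section

variable {F K V : Type*} [Field F] [Field K] [Algebra F K] [AddCommGroup V] [Module F V]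

/-- `V` regarded as a `K`-module through `φ`. -/
@[nolint unusedArguments]
def AlgHomModule (_φ : K →ₐ[F] End F V) : Type _ := V

/-- The linear automorphisms of `V` act on the representations of `K` on `V` by conjugation. -/
instance conjMulAction : MulAction (V ≃ₗ[F] V) (K →ₐ[F] End F V) where
  smul g φ := (g.conjAlgEquiv F : End F V →ₐ[F] End F V).comp φ
  one_smul _ := rfl
  mul_smul _ _ _ := rfl

instance [Finite F] [Finite V] [FiniteDimensional F K] : Finite (K →ₐ[F] End F V) :=
  have : Finite K := Module.finite_of_finite F
  DFunLike.finite _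

namespace AlgHomModule

variable (φ : K →ₐ[F] End F V)

instance : AddCommGroup (AlgHomModule φ) := inferInstanceAs (AddCommGroup V)
instance : Module F (AlgHomModule φ) := inferInstanceAs (Module F V)
instance : Module K (AlgHomModule φ) := Module.compHom V φ.toRingHom
instance [FiniteDimensional F V] : FiniteDimensional F (AlgHomModule φ) :=
  inferInstanceAs (FiniteDimensional F V)

instance : IsScalarTower F K (AlgHomModule φ) where
  smul_assoc r k v := DFunLike.congr_fun (map_smul φ r k) v

instance [FiniteDimensional F V] : FiniteDimensional K (AlgHomModule φ) :=
  Module.Finite.of_restrictScalars_finite F K _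

theorem finrank_mul_finrank_eq : finrank F K * finrank K (AlgHomModule φ) = finrank F V :=
  finrank_mul_finrank F K (AlgHomModule φ)

/-- The linear automorphisms commuting with the image of `φ` are the `K`-linear ones. -/
def stabilizerEquiv :
    MulAction.stabilizer (V ≃ₗ[F] V) φ ≃ (AlgHomModule φ ≃ₗ[K] AlgHomModule φ) where
  toFun g :=
    { g.1 with
      map_smul' := fun k v => by
        have h := DFunLike.congr_fun (DFunLike.congr_fun g.2 k) (g.1 (v : V))
        exact (congrArg (fun w : V => g.1 (φ k w)) (g.1.symm_apply_apply (v : V))).symm.trans h }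
  invFun e := ⟨e.restrictScalars F, by
    ext k v
    exact (e.map_smul k (e.symm v)).trans (congrArg (k • ·) (e.apply_symm_apply v))⟩
  left_inv _ := rfl
  right_inv _ := rfl

end AlgHomModule

variable [FiniteDimensional F K]

theorem nonempty_algHom_end_iff [FiniteDimensional F V] :
    Nonempty (K →ₐ[F] End F V) ↔ finrank F K ∣ finrank F V := by
  refine ⟨fun ⟨φ⟩ => ⟨_, (AlgHomModule.finrank_mul_finrank_eq φ).symm⟩, fun ⟨m, hm⟩ => ?_⟩
  have hV : finrank F (Fin m → K) = finrank F V := by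
    rw [hm, finrank_pi_fintype]; simp [mul_comm]
  exact ⟨((LinearEquiv.ofFinrankEq _ V hV).conjAlgEquiv F : End F (Fin m → K) →ₐ[F] End F V).comp
    (Algebra.lsmul F F (Fin m → K))⟩

/-- Skolem–Noether: both representations make `V` a `K`-vector space of the same dimension. -/
instance conj_isPretransitive [FiniteDimensional F V] :
    MulAction.IsPretransitive (V ≃ₗ[F] V) (K →ₐ[F] End F V) where
  exists_smul_eq φ ψ := by
    have h : finrank K (AlgHomModule φ) = finrank K (AlgHomModule ψ) :=
      Nat.eq_of_mul_eq_mul_left (finrank_pos (R := F) (M := K)) <|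
        (AlgHomModule.finrank_mul_finrank_eq φ).trans (AlgHomModule.finrank_mul_finrank_eq ψ).symm
    let e : AlgHomModule φ ≃ₗ[K] AlgHomModule ψ := LinearEquiv.ofFinrankEq _ _ h
    let g : V ≃ₗ[F] V := e.restrictScalars F
    refine ⟨g, ?_⟩
    ext k v
    exact (e.map_smul k (e.symm v)).trans (congrArg (k • ·) (e.apply_symm_apply v))

theorem card_smul_algHom_eq_mul [FiniteDimensional F V] (φ ψ : K →ₐ[F] End F V) :
    Nat.card {g : V ≃ₗ[F] V // g • φ = ψ} * Nat.card (K →ₐ[F] End F V) =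
      Nat.card (V ≃ₗ[F] V) := by
  have hψ : ψ ∈ MulAction.orbit (V ≃ₗ[F] V) φ := MulAction.exists_smul_eq _ φ ψ
  rw [← card_smul_eq_mul_card_orbit hψ, MulAction.orbit_eq_univ, Nat.card_congr (Equiv.Set.univ _)]

end

theorem card_linearEquiv (K V : Type*) [Field K] [Finite K] [AddCommGroup V] [Module K V]
    [FiniteDimensional K V] :
    Nat.card (V ≃ₗ[K] V) =
      ∏ i ∈ Finset.range (finrank K V), (Nat.card K ^ finrank K V - Nat.card K ^ i) := by
  have := Fintype.ofFinite K
  rw [Nat.card_congr (LinearMap.GeneralLinearGroup.generalLinearEquiv K V).symm.toEquiv,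
    Nat.card_congr (Units.mapEquiv
      (LinearMap.toMatrixAlgEquiv (finBasis K V)).toMulEquiv).toEquiv,
    Finset.prod_range, Nat.card_eq_fintype_card (α := K)]
  exact Matrix.card_GL_field _

/-- The order of `GL (n / d) (q ^ d)`, for `d` dividing `n`. -/
def glOrder (q n d : ℕ) : ℕ := ∏ i ∈ Finset.range (n / d), (q ^ n - q ^ (d * i))

theorem card_linearEquiv_eq_glOrder {F K V : Type*} [Field F] [Finite F] [Field K] [Algebra F K]
    [FiniteDimensional F K] [AddCommGroup V] [Module F V] [Module K V] [IsScalarTower F K V]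
    [FiniteDimensional F V] :
    Nat.card (V ≃ₗ[K] V) = glOrder (Nat.card F) (finrank F V) (finrank F K) := by
  have : Finite K := Module.finite_of_finite F
  have : FiniteDimensional K V := Module.Finite.of_restrictScalars_finite F K V
  rw [card_linearEquiv, Module.natCard_eq_pow_finrank (K := F) (V := K), glOrder,
    ← finrank_mul_finrank F K V, Nat.mul_div_cancel_left _ finrank_pos]
  simp only [pow_mul]

theorem card_algHom_end_mul_glOrder {F K V : Type*} [Field F] [Finite F] [Field K] [Algebra F K]
    [FiniteDimensional F K] [AddCommGroup V] [Module F V] [FiniteDimensional F V]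
    (h : finrank F K ∣ finrank F V) :
    Nat.card (K →ₐ[F] End F V) * glOrder (Nat.card F) (finrank F V) (finrank F K) =
      glOrder (Nat.card F) (finrank F V) 1 := by
  obtain ⟨φ⟩ := nonempty_algHom_end_iff.2 h
  have hV : Nat.card (V ≃ₗ[F] V) = glOrder (Nat.card F) (finrank F V) 1 := by
    rw [card_linearEquiv_eq_glOrder (F := F), finrank_self]
  have hφ : Nat.card (MulAction.stabilizer (V ≃ₗ[F] V) φ) =
      glOrder (Nat.card F) (finrank F V) (finrank F K) := by
    rw [Nat.card_congr (AlgHomModule.stabilizerEquiv φ), card_linearEquiv_eq_glOrder (F := F)]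
    rfl
  rw [← hV, ← hφ, mul_comm]
  exact card_smul_algHom_eq_mul φ φ

/-! ### Elements lying in few proper subrings -/

/-- The subring of the endomorphisms leaving `U` invariant. -/
def stabilizerSubring {F V : Type*} [Field F] [AddCommGroup V] [Module F V]
    (U : Submodule F V) : NonUnitalSubring (End F V) where
  carrier := {a | U ∈ End.invtSubmodule a}
  zero_mem' _ _ := U.zero_mem
  add_mem' ha hb _ hu := U.add_mem (ha hu) (hb hu)
  neg_mem' ha _ hu := U.neg_mem (ha hu)
  mul_mem' ha hb _ hu := ha (hb hu)

/-- An endomorphism `x` which lies in few maximal subrings: its proper nonzero invariant subspaces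
are at most one of dimension `k` and at most one of complementary dimension, every
subring containing `x` contains the scalars, and `x` commutes with few fields: each extension `K`
of `F` has at most `(finrank F K) ^ r` representations commuting with `x`, and none unless
its degree divides `k`. Every finite extension of `F` is isomorphic to one in `Type`, which is why
`K` ranges over that universe only. -/
structure IsTestElement {F V : Type*} [Field F] [AddCommGroup V] [Module F V] (x : End F V)
    (k r : ℕ) : Prop where
  algebraMap_mem : ∀ S : NonUnitalSubring (End F V), x ∈ S → ∀ c : F, algebraMap F (End F V) c ∈ S
  finrank_eq : ∀ U ∈ End.invtSubmodule x, U ≠ ⊥ → U ≠ ⊤ →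
    finrank F U = k ∨ finrank F U + k = finrank F V
  eq_of_finrank_eq : ∀ U ∈ End.invtSubmodule x, ∀ W ∈ End.invtSubmodule x,
    finrank F U = finrank F W → U = W
  card_commute_le : ∀ (K : Type) [Field K] [Algebra F K] [FiniteDimensional F K],
    Nat.card {φ : K →ₐ[F] End F V // ∀ a, Commute (φ a) x} ≤ finrank F K ^ r
  dvd_of_commute : ∀ (K : Type) [Field K] [Algebra F K] [FiniteDimensional F K]
    (φ : K →ₐ[F] End F V), (∀ a, Commute (φ a) x) → finrank F K ∣ k

theorem mem_of_closure_singleton_eq_top {R : Type*} [NonUnitalRing R] {θ : R}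
    (hθ : NonUnitalSubring.closure {θ} = ⊤) {S : NonUnitalSubring R} (h : θ ∈ S) (x : R) :
    x ∈ S :=
  (NonUnitalSubring.closure_le (t := S)).2 (Set.singleton_subset_iff.2 h) (hθ ▸ trivial)

section RegularRepresentation

variable {F V B : Type*} [Field F] [AddCommGroup V] [Module F V] [CommRing B] [Algebra F B]
  (e : B ≃ₗ[F] V)

/-- The regular representation of `B`, transported to `V` along `e`. -/
def regularRep : B →ₐ[F] End F V :=
  (e.conjAlgEquiv F : End F B →ₐ[F] End F V).comp (Algebra.lmul F B)

theorem regularRep_apply_apply (b c : B) : regularRep e b (e c) = e (b * c) := by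
  simp [regularRep]

theorem regularRep_injective : Function.Injective (regularRep e) := fun b c h => by
  have := DFunLike.congr_fun h (e 1)
  simpa only [regularRep_apply_apply, mul_one, e.injective.eq_iff] using this

variable {e} {θ : B} (hθ : NonUnitalSubring.closure {θ} = ⊤)
include hθ

theorem exists_ideal_map_eq_of_mem_invtSubmodule {U : Submodule F V}
    (hU : U ∈ End.invtSubmodule (regularRep e θ)) :
    ∃ I : Ideal B, (I.restrictScalars F).map (e : B →ₗ[F] V) = U := by
  have stable (b : B) : b ∈ (stabilizerSubring U).comap (regularRep e) :=
    mem_of_closure_singleton_eq_top hθ hU b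
  refine ⟨{ U.comap (e : B →ₗ[F] V) with smul_mem' := fun b c hc => ?_ },
    Submodule.map_comap_eq_of_surjective e.surjective U⟩
  have := stable b hc
  rwa [Submodule.mem_comap, LinearEquiv.coe_coe, regularRep_apply_apply] at this

theorem mem_range_regularRep_of_commute {f : End F V} (hf : Commute f (regularRep e θ)) :
    f ∈ (regularRep e).range := by
  have comm (b : B) : regularRep e b ∈ NonUnitalSubring.centralizer {f} :=
    mem_of_closure_singleton_eq_top hθ
      (S := (NonUnitalSubring.centralizer {f}).comap (regularRep e))
      (by simpa [NonUnitalSubring.mem_centralizer_iff] using hf.eq) b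
  refine ⟨e.symm (f (e 1)), LinearMap.ext fun v => ?_⟩
  obtain ⟨b, rfl⟩ := e.surjective v
  have hb := DFunLike.congr_fun (NonUnitalSubring.mem_centralizer_iff.1 (comm b) f rfl) (e 1)
  calc regularRep e (e.symm (f (e 1))) (e b) = e (b * e.symm (f (e 1))) := by
        rw [regularRep_apply_apply, mul_comm]
    _ = regularRep e b (f (e 1)) := by rw [← regularRep_apply_apply, e.apply_symm_apply]
    _ = f (regularRep e b (e 1)) := hb.symm
    _ = f (e b) := by rw [regularRep_apply_apply, mul_one]

theorem exists_injective_commute_to_algHom (K : Type*) [Field K] [Algebra F K] :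
    ∃ j : {φ : K →ₐ[F] End F V // ∀ a, Commute (φ a) (regularRep e θ)} → (K →ₐ[F] B),
      Function.Injective j := by
  let π := ((AlgEquiv.ofInjective _ (regularRep_injective e)).symm :
    (regularRep e).range →ₐ[F] B)
  have hπ : Function.Injective π := AlgEquiv.injective _
  refine ⟨fun φ => π.comp (φ.1.codRestrict _ fun a =>
    mem_range_regularRep_of_commute hθ (φ.2 a)), fun φ ψ h => ?_⟩
  exact Subtype.ext <| AlgHom.ext fun a => congrArg Subtype.val (hπ (DFunLike.congr_fun h a))

variable [FiniteDimensional F B]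

theorem isTestElement_regularRep [Finite F] {k r : ℕ}
    (hk : ∀ I : Ideal B, I ≠ ⊥ → I ≠ ⊤ → finrank F I = k ∨ finrank F I + k = finrank F B)
    (hunique : ∀ I J : Ideal B, finrank F I = finrank F J → I = J)
    (hcard : ∀ (K : Type) [Field K] [Algebra F K] [FiniteDimensional F K],
      Nat.card (K →ₐ[F] B) ≤ finrank F K ^ r)
    (hdvd : ∀ (K : Type) [Field K] [Algebra F K] [FiniteDimensional F K] (_ : K →ₐ[F] B),
      finrank F K ∣ k) :
    IsTestElement (regularRep e θ) k r := by
  have hmap (I : Ideal B) :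
      finrank F ((I.restrictScalars F).map (e : B →ₗ[F] V)) = finrank F I :=
    LinearEquiv.finrank_map_eq e (I.restrictScalars F)
  refine ⟨fun S hS c => ?_, fun U hU hbot htop => ?_, fun U hU W hW hUW => ?_,
    fun K _ _ _ => ?_, fun K _ _ _ φ hφ => ?_⟩
  · exact (regularRep e).commutes c ▸ mem_of_closure_singleton_eq_top hθ
      (S := S.comap (regularRep e)) hS (algebraMap F B c)
  · obtain ⟨I, rfl⟩ := exists_ideal_map_eq_of_mem_invtSubmodule hθ hU
    rw [hmap, ← e.finrank_eq]
    refine hk I ?_ ?_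
    · rintro rfl
      simp at hbot
    · rintro rfl
      simp at htop
  · obtain ⟨I, rfl⟩ := exists_ideal_map_eq_of_mem_invtSubmodule hθ hU
    obtain ⟨J, rfl⟩ := exists_ideal_map_eq_of_mem_invtSubmodule hθ hW
    rw [hmap, hmap] at hUW
    rw [hunique I J hUW]
  · have : Finite K := Module.finite_of_finite F
    have : Finite B := Module.finite_of_finite F
    have : Finite (K →ₐ[F] B) := DFunLike.finite _
    obtain ⟨j, hj⟩ := exists_injective_commute_to_algHom (e := e) hθ K
    exact (Nat.card_le_card_of_injective j hj).trans (hcard K)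
  · obtain ⟨j, -⟩ := exists_injective_commute_to_algHom (e := e) hθ K
    exact hdvd K (j ⟨φ, hφ⟩)

end RegularRepresentation

section PrimitiveElement

variable {L : Type*} [Field L]

theorem exists_isPrimitiveRoot_card_sub_one [Finite L] :
    ∃ θ : L, IsPrimitiveRoot θ (Nat.card L - 1) := by
  obtain ⟨g, hg⟩ := IsCyclic.exists_generator (α := Lˣ)
  refine ⟨g, IsPrimitiveRoot.coe_units_iff.2 ?_⟩
  rw [← Nat.card_units, ← orderOf_eq_card_of_forall_mem_zpowers hg]
  exact IsPrimitiveRoot.orderOf g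

theorem exists_pow_succ_eq [Finite L] {θ : L} (hθ : IsPrimitiveRoot θ (Nat.card L - 1)) {y : L}
    (hy : y ≠ 0) : ∃ i : ℕ, θ ^ (i + 1) = y := by
  have := Fintype.ofFinite L
  have : NeZero (Nat.card L - 1) := ⟨Nat.sub_ne_zero_of_lt Finite.one_lt_card⟩
  have hθ0 : θ ≠ 0 := hθ.ne_zero this.ne
  obtain ⟨i, -, hi⟩ := hθ.eq_pow_of_pow_eq_one (ξ := y / θ) <| by
    rw [Nat.card_eq_fintype_card]
    exact FiniteField.pow_card_sub_one_eq_one _ (div_ne_zero hy hθ0)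
  exact ⟨i, by rw [pow_succ, hi, div_mul_cancel₀ _ hθ0]⟩

theorem pow_succ_mem {R : Type*} [Ring R] {S : NonUnitalSubring R} {x : R} (hx : x ∈ S) (i : ℕ) :
    x ^ (i + 1) ∈ S := by
  induction i with
  | zero => simpa using hx
  | succ i ih => exact pow_succ x (i + 1) ▸ S.mul_mem ih hx

theorem mem_of_isPrimitiveRoot_mem [Finite L] {θ : L} (hθ : IsPrimitiveRoot θ (Nat.card L - 1))
    {S : NonUnitalSubring L} (h : θ ∈ S) (y : L) : y ∈ S := by
  by_cases hy : y = 0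
  · exact hy ▸ S.zero_mem
  · obtain ⟨i, rfl⟩ := exists_pow_succ_eq hθ hy
    exact pow_succ_mem h i

theorem pow_card_eq_self [Finite L] (y : L) : y ^ Nat.card L = y := by
  have := Fintype.ofFinite L
  rw [Nat.card_eq_fintype_card, FiniteField.pow_card]

theorem pow_ne_self_of_isPrimitiveRoot {θ : L} {d N : ℕ} (hθ : IsPrimitiveRoot θ d)
    (hN : 1 < N) (hd : N ≤ d) : θ ^ N ≠ θ := by
  intro h
  have hθ0 : θ ≠ 0 := hθ.ne_zero (by lia)
  have hpow : θ ^ (N - 1) = 1 := by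
    rw [← mul_left_inj' hθ0, one_mul, ← pow_succ, Nat.sub_add_cancel hN.le, h]
  have := Nat.le_of_dvd (by lia) (hθ.dvd_of_pow_eq_one _ hpow)
  lia

end PrimitiveElement

section Generators

variable {L : Type*} [Field L] [Finite L] {α : L} (hα : IsPrimitiveRoot α (Nat.card L - 1))
include hα

theorem closure_singleton_isPrimitiveRoot : NonUnitalSubring.closure {α} = ⊤ :=
  eq_top_iff.2 fun y _ =>
    mem_of_isPrimitiveRoot_mem hα (NonUnitalSubring.subset_closure (Set.mem_singleton _)) y

/-- The power `|L|` of `(α, β)` has first coordinate `α`, which separates the two factors. -/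
theorem closure_singleton_prodMk {M : Type*} [Field M] [Finite M] {β : M}
    (hβ : IsPrimitiveRoot β (Nat.card M - 1)) (hlt : Nat.card L < Nat.card M) :
    NonUnitalSubring.closure {(α, β)} = ⊤ := by
  set S := NonUnitalSubring.closure {(α, β)}
  have hS : (α, β) ∈ S := NonUnitalSubring.subset_closure (Set.mem_singleton _)
  let γ := β ^ Nat.card L - β
  have hγ : γ ≠ 0 :=
    sub_ne_zero.2 (pow_ne_self_of_isPrimitiveRoot hβ Finite.one_lt_card (Nat.le_sub_one_of_lt hlt))
  have hγS : ((0 : L), γ) ∈ S := by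
    have h := S.sub_mem (pow_succ_mem hS (Nat.card L - 1)) hS
    rwa [Nat.sub_add_cancel Nat.card_pos, Prod.pow_mk, Prod.mk_sub_mk, pow_card_eq_self,
      sub_self] at h
  have hright (y : M) : ((0 : L), y) ∈ S := by
    by_cases hy : y = 0
    · exact hy ▸ S.zero_mem
    · obtain ⟨i, hi⟩ := exists_pow_succ_eq hβ (div_ne_zero hy hγ)
      have := S.mul_mem (pow_succ_mem hS i) hγS
      rwa [Prod.pow_mk, Prod.mk_mul_mk, mul_zero, hi, div_mul_cancel₀ _ hγ] at this
  have hleft (y : L) : (y, (0 : M)) ∈ S :=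
    mem_of_isPrimitiveRoot_mem hα (S := S.comap (NonUnitalAlgHom.inl ℤ L M))
      (by simpa using S.sub_mem hS (hright β)) y
  exact eq_top_iff.2 fun y _ => by simpa using S.add_mem (hleft y.1) (hright y.2)

open TrivSqZeroExt in
/-- Frobenius kills the nilpotent part of `α + ε`, which therefore generates `α` and `ε`. -/
theorem closure_singleton_inl_add_inr :
    NonUnitalSubring.closure {(inl α + inr 1 : TrivSqZeroExt L L)} = ⊤ := by
  set S := NonUnitalSubring.closure {(inl α + inr 1 : TrivSqZeroExt L L)}
  have hS : inl α + inr 1 ∈ S := NonUnitalSubring.subset_closure (Set.mem_singleton _)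
  have hαS : (inl α : TrivSqZeroExt L L) ∈ S := by
    have hfrob : (inl α + inr 1 : TrivSqZeroExt L L) ^ Nat.card L = inl α := by
      ext
      · simp [pow_card_eq_self]
      · have := Fintype.ofFinite L
        rw [snd_pow, ← Nat.cast_smul_eq_nsmul L]
        simp
    have h := pow_succ_mem hS (Nat.card L - 1)
    rwa [Nat.sub_add_cancel Nat.card_pos, hfrob] at h
  have hinl (y : L) : (inl y : TrivSqZeroExt L L) ∈ S :=
    mem_of_isPrimitiveRoot_mem hα (S := S.comap (inlHom L L)) hαS y
  have hε : (inr 1 : TrivSqZeroExt L L) ∈ S := by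
    simpa only [add_sub_cancel_left] using S.sub_mem hS hαS
  refine eq_top_iff.2 fun y _ => ?_
  have hy : y = inl y.fst + inl y.snd * inr 1 := by ext <;> simp
  exact hy ▸ S.add_mem (hinl _) (S.mul_mem (hinl _) hε)

end Generators

section Ideals

variable {F L M : Type*} [Field F] [Field L] [Algebra F L] [FiniteDimensional F L] [Field M]

theorem finrank_ideal_prod {A B : Type*} [CommRing A] [Algebra F A] [FiniteDimensional F A]
    [CommRing B] [Algebra F B] [FiniteDimensional F B] (I : Ideal A) (J : Ideal B) :
    finrank F (I.prod J) = finrank F I + finrank F J := by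
  let e : I.prod J ≃ₗ[F] I × J :=
    { toFun := fun x => (⟨x.1.1, x.2.1⟩, ⟨x.1.2, x.2.2⟩)
      invFun := fun x => ⟨(x.1, x.2), x.1.2, x.2.2⟩
      map_add' := fun _ _ => rfl
      map_smul' := fun _ _ => rfl
      left_inv := fun _ => rfl
      right_inv := fun _ => rfl }
  rw [e.finrank_eq, finrank_prod]

theorem finrank_ideal_top (A : Type*) [CommRing A] [Algebra F A] :
    finrank F (⊤ : Ideal A) = finrank F A :=
  finrank_top F A

theorem finrank_ideal_bot (A : Type*) [CommRing A] [Algebra F A] :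
    finrank F (⊥ : Ideal A) = 0 :=
  finrank_bot F A

theorem ideal_prod_cases (I : Ideal (L × M)) :
    I = ⊥ ∨ I = Ideal.prod ⊤ ⊥ ∨ I = Ideal.prod ⊥ ⊤ ∨ I = ⊤ := by
  rw [Ideal.ideal_prod_eq I]
  rcases Ideal.eq_bot_or_top (I.map (RingHom.fst L M)) with hL | hL <;>
  rcases Ideal.eq_bot_or_top (I.map (RingHom.snd L M)) with hM | hM <;>
  simp [hL, hM]

open TrivSqZeroExt in
theorem ideal_trivSqZeroExt_cases (I : Ideal (TrivSqZeroExt L L)) :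
    I = ⊥ ∨ I = kerIdeal L L ∨ I = ⊤ := by
  refine or_iff_not_imp_left.2 fun hbot => or_iff_not_imp_right.2 fun htop => ?_
  have hle (x) (hx : x ∈ I) : x.fst = 0 := by
    by_contra h0
    exact htop (Ideal.eq_top_of_isUnit_mem I hx (isUnit_iff_isUnit_fst.2 (isUnit_iff_ne_zero.2 h0)))
  obtain ⟨x, hx, hx0⟩ := Submodule.exists_mem_ne_zero_of_ne_bot hbot
  have hsnd : x.snd ≠ 0 := fun h => hx0 (TrivSqZeroExt.ext (hle x hx) h)
  refine le_antisymm hle fun y (hy : y.fst = 0) => ?_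
  have hyx : y = inl (y.snd / x.snd) * x := by
    ext
    · simp [hy, hle x hx]
    · simp [hsnd]
  exact hyx ▸ I.mul_mem_left _ hx

instance : FiniteDimensional F (TrivSqZeroExt L L) := inferInstanceAs (FiniteDimensional F (L × L))

theorem finrank_trivSqZeroExt : finrank F (TrivSqZeroExt L L) = finrank F L + finrank F L :=
  finrank_prod (R := F) (M := L) (M' := L)

end Ideals

theorem finrank_kerIdeal {F L : Type*} [Field F] [Field L] [Algebra F L] :
    finrank F (TrivSqZeroExt.kerIdeal L L) = finrank F L := by
  let e : TrivSqZeroExt.kerIdeal L L ≃ₗ[F] L :=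
    { toFun := fun x => x.1.snd
      invFun := fun y => ⟨TrivSqZeroExt.inr y, TrivSqZeroExt.fst_inr L y⟩
      map_add' := fun _ _ => rfl
      map_smul' := fun _ _ => rfl
      left_inv := fun x => Subtype.ext ((TrivSqZeroExt.mem_kerIdeal_iff_inr L L x.1).1 x.2).symm
      right_inv := fun _ => rfl }
  exact e.finrank_eq

section Existence

variable {F V : Type*} [Field F] [Finite F] [AddCommGroup V] [Module F V]

/-- A Singer cycle. -/
theorem exists_isTestElement_zero [FiniteDimensional F V] (hV : finrank F V ≠ 0) :
    ∃ x : End F V, IsTestElement x 0 1 := by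
  obtain ⟨L, _, _, _, hL⟩ := exists_field_finrank_eq F hV
  have : Finite L := Module.finite_of_finite F
  obtain ⟨θ, hθ⟩ := exists_isPrimitiveRoot_card_sub_one (L := L)
  refine ⟨_, isTestElement_regularRep (e := LinearEquiv.ofFinrankEq L V hL)
    (closure_singleton_isPrimitiveRoot hθ) (fun I hbot htop => ?_) (fun I J hIJ => ?_)
    (fun K _ _ _ => ?_) fun K _ _ _ _ => dvd_zero _⟩
  · exact (htop ((Ideal.eq_bot_or_top I).resolve_left hbot)).elim
  · have : 0 < finrank F L := finrank_pos
    rcases Ideal.eq_bot_or_top I with rfl | rfl <;> rcases Ideal.eq_bot_or_top J with rfl | rfl <;>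
    simp only [finrank_ideal_bot, finrank_ideal_top] at hIJ ⊢ <;> lia
  · exact (pow_one (finrank F K)).symm ▸ card_algHom_le_finrank F K L

theorem card_algHom_prod_le {K L M : Type*} [Field K] [Algebra F K] [FiniteDimensional F K]
    [Field L] [Algebra F L] [Field M] [Algebra F M] :
    Nat.card (K →ₐ[F] L × M) ≤ finrank F K ^ 2 := by
  rw [← Nat.card_congr AlgHom.prodEquiv, Nat.card_prod, sq]
  exact Nat.mul_le_mul (card_algHom_le_finrank F K L) (card_algHom_le_finrank F K M)

open TrivSqZeroExt in
/-- Separability makes embeddings rigid under the square-zero thickening. -/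
theorem card_algHom_trivSqZeroExt_le {K L : Type*} [Field K] [Algebra F K] [FiniteDimensional F K]
    [Field L] [Algebra F L] :
    Nat.card (K →ₐ[F] TrivSqZeroExt L L) ≤ finrank F K := by
  have : Algebra.FormallyUnramified F K := Algebra.FormallyUnramified.of_isSeparable F K
  refine (Nat.card_le_card_of_injective (fun f => (fstHom F L L).comp f) fun f g h => ?_).trans
    (card_algHom_le_finrank F K L)
  exact Algebra.FormallyUnramified.lift_unique' (fstHom F L L) ⟨2, kerIdeal_sq L L⟩ f g h

theorem exists_isTestElement_of_lt [FiniteDimensional F V] {k : ℕ} (hk : 0 < k)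
    (hkV : 2 * k < finrank F V) : ∃ x : End F V, IsTestElement x k 2 := by
  obtain ⟨L, _, _, _, hL⟩ := exists_field_finrank_eq F hk.ne'
  obtain ⟨M, _, _, _, hM⟩ := exists_field_finrank_eq F (d := finrank F V - k) (by lia)
  have : Finite L := Module.finite_of_finite F
  have : Finite M := Module.finite_of_finite F
  obtain ⟨α, hα⟩ := exists_isPrimitiveRoot_card_sub_one (L := L)
  obtain ⟨β, hβ⟩ := exists_isPrimitiveRoot_card_sub_one (L := M)
  have hcard : Nat.card L < Nat.card M := by
    rw [Module.natCard_eq_pow_finrank (K := F) (V := L),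
      Module.natCard_eq_pow_finrank (K := F) (V := M), hL, hM]
    exact Nat.pow_lt_pow_right Finite.one_lt_card (by lia)
  have hLM : finrank F (L × M) = finrank F V := by rw [finrank_prod]; lia
  refine ⟨_, isTestElement_regularRep (e := LinearEquiv.ofFinrankEq (L × M) V hLM)
    (closure_singleton_prodMk hα hβ hcard) (fun I hbot htop => ?_) (fun I J hIJ => ?_)
    (fun K _ _ _ => card_algHom_prod_le) fun K _ _ _ φ => ?_⟩
  · rcases ideal_prod_cases I with rfl | rfl | rfl | rfl <;>
    simp only [finrank_ideal_prod, finrank_ideal_bot, finrank_ideal_top, finrank_prod] <;> grind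
  · rcases ideal_prod_cases I with rfl | rfl | rfl | rfl <;>
    rcases ideal_prod_cases J with rfl | rfl | rfl | rfl <;>
    simp only [finrank_ideal_prod, finrank_ideal_bot, finrank_ideal_top, finrank_prod] at hIJ ⊢ <;>
    lia
  · exact hL ▸ FiniteField.nonempty_algHom_iff_finrank_dvd.1 ⟨(AlgHom.fst F L M).comp φ⟩

theorem exists_isTestElement_of_eq [FiniteDimensional F V] {k : ℕ} (hk : 0 < k)
    (hkV : 2 * k = finrank F V) : ∃ x : End F V, IsTestElement x k 2 := by
  obtain ⟨L, _, _, _, hL⟩ := exists_field_finrank_eq F hk.ne'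
  have : Finite L := Module.finite_of_finite F
  obtain ⟨α, hα⟩ := exists_isPrimitiveRoot_card_sub_one (L := L)
  have hdim : finrank F (TrivSqZeroExt L L) = finrank F V := by
    rw [finrank_trivSqZeroExt]; lia
  refine ⟨_, isTestElement_regularRep (e := LinearEquiv.ofFinrankEq (TrivSqZeroExt L L) V hdim)
    (closure_singleton_inl_add_inr hα) (fun I hbot htop => ?_) (fun I J hIJ => ?_)
    (fun K _ _ _ => card_algHom_trivSqZeroExt_le.trans (Nat.le_self_pow two_ne_zero _))
    fun K _ _ _ φ => ?_⟩
  · rcases ideal_trivSqZeroExt_cases I with rfl | rfl | rfl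
    · exact (hbot rfl).elim
    · exact Or.inl (finrank_kerIdeal.trans hL)
    · exact (htop rfl).elim
  · rcases ideal_trivSqZeroExt_cases I with rfl | rfl | rfl <;>
    rcases ideal_trivSqZeroExt_cases J with rfl | rfl | rfl <;>
    simp only [finrank_kerIdeal, finrank_ideal_bot, finrank_ideal_top,
      finrank_trivSqZeroExt] at hIJ ⊢ <;> lia
  · exact hL ▸ FiniteField.nonempty_algHom_iff_finrank_dvd.1
      ⟨(TrivSqZeroExt.fstHom F L L).comp φ⟩

theorem exists_isTestElement [FiniteDimensional F V] {k : ℕ} (hk : 0 < k)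
    (hkV : 2 * k ≤ finrank F V) : ∃ x : End F V, IsTestElement x k 2 :=
  hkV.lt_or_eq.elim (exists_isTestElement_of_lt hk) (exists_isTestElement_of_eq hk)

end Existence

/-! ### Estimates for orders of general linear groups -/

theorem one_div_four_le_prod_one_sub_pow {x : ℚ} (hx₀ : 0 ≤ x) (hx : x ≤ 1 / 2) (n : ℕ) :
    1 / 4 ≤ ∏ j ∈ Finset.range n, (1 - x ^ (j + 1)) := by
  -- The term `(1 / 2) ^ (m + 2)` makes the estimate inductive.
  have strong (m : ℕ) :
      1 / 4 + (1 / 2) ^ (m + 2) ≤ ∏ j ∈ Finset.range (m + 1), (1 - x ^ (j + 1)) := by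
    induction m with
    | zero => norm_num; linarith
    | succ m ih =>
      have hpow : x ^ (m + 2) ≤ (1 / 2) ^ (m + 2) := pow_le_pow_left₀ hx₀ hx _
      have hquarter : (1 / 2 : ℚ) ^ (m + 2) ≤ (1 / 2) ^ 2 :=
        pow_le_pow_of_le_one (by norm_num) (by norm_num) (by lia)
      have hpos : (0 : ℚ) < (1 / 2) ^ (m + 2) := by positivity
      rw [Finset.prod_range_succ, pow_succ _ (m + 2)]
      set t : ℚ := (1 / 2) ^ (m + 2)
      calc 1 / 4 + t * (1 / 2) ≤ (1 / 4 + t) * (1 - t) := by nlinarith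
        _ ≤ _ := mul_le_mul ih (by linarith) (by linarith) (by linarith)
  cases n with
  | zero => norm_num
  | succ m => exact le_trans (by simp) (strong m)

theorem cast_glOrder_one {q : ℕ} (hq : 0 < q) (n : ℕ) :
    (glOrder q n 1 : ℚ) =
      ((q : ℚ) ^ n) ^ n * ∏ j ∈ Finset.range n, (1 - (1 / (q : ℚ)) ^ (j + 1)) := by
  have hq' : (q : ℚ) ≠ 0 := by exact_mod_cast hq.ne'
  have hconst : ((q : ℚ) ^ n) ^ n = ∏ _i ∈ Finset.range n, (q : ℚ) ^ n := by simp
  rw [← Finset.prod_range_reflect, hconst, ← Finset.prod_mul_distrib, glOrder, Nat.cast_prod,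
    Nat.div_one]
  refine Finset.prod_congr rfl fun i hi => ?_
  have hi := Finset.mem_range.1 hi
  rw [one_mul, Nat.cast_sub (Nat.pow_le_pow_right hq hi.le), mul_sub, mul_one, Nat.cast_pow,
    Nat.cast_pow, show n - 1 - i + 1 = n - i by lia, one_div, inv_pow, pow_sub₀ _ hq' hi.le]
  field_simp

theorem pow_pow_le_four_mul_glOrder_one {q : ℕ} (hq : 2 ≤ q) (n : ℕ) :
    (q ^ n) ^ n ≤ 4 * glOrder q n 1 := by
  have hq' : (2 : ℚ) ≤ q := by exact_mod_cast hq
  have hprod := one_div_four_le_prod_one_sub_pow (x := 1 / q) (by positivity)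
    (one_div_le_one_div_of_le two_pos hq') n
  have hpos : (0 : ℚ) < ((q : ℚ) ^ n) ^ n := by positivity
  have : ((q : ℚ) ^ n) ^ n ≤ 4 * glOrder q n 1 := by
    rw [cast_glOrder_one (by lia)]
    nlinarith
  exact_mod_cast this

theorem glOrder_pos {q n d : ℕ} (hq : 2 ≤ q) : 0 < glOrder q n d := by
  refine Finset.prod_pos fun i hi => Nat.sub_pos_of_lt (Nat.pow_lt_pow_right hq ?_)
  have hi := Finset.mem_range.1 hi
  rcases Nat.eq_zero_or_pos d with rfl | hd
  · lia
  · exact (Nat.mul_lt_mul_of_pos_left hi hd).trans_le (Nat.mul_div_le n d)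

theorem glOrder_le_pow (q n d : ℕ) : glOrder q n d ≤ (q ^ n) ^ (n / d) :=
  (Finset.prod_le_pow_card _ _ _ fun _ _ => Nat.sub_le _ _).trans_eq (by simp)

theorem mul_sub_le_glOrder {q b l m : ℕ} (hq : 2 ≤ q) (hb : 0 < b) (hm : m ≤ l) :
    (∏ i ∈ Finset.range m, (q ^ (b * (l + 1)) - q ^ (b * i))) *
      (q ^ (b * (l + 1)) - q ^ (b * l)) ≤ glOrder q (b * (l + 1)) b := by
  rw [glOrder, Nat.mul_div_cancel_left _ hb, Finset.prod_range_succ]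
  refine Nat.mul_le_mul_right _ (Finset.prod_le_prod_of_subset_of_one_le'
    (Finset.range_mono hm) fun i hi _ => ?_)
  have hi := Finset.mem_range.1 hi
  exact Nat.sub_pos_of_lt (Nat.pow_lt_pow_right hq (Nat.mul_lt_mul_of_pos_left (by lia) hb))

theorem four_mul_mul_glOrder_le {q n b p : ℕ} (hq : 2 ≤ q) (hb : 2 ≤ b) (hbp : b < p)
    (hbn : b ∣ n) (hpn : p ∣ n) (hn : 2 * p ≤ n) :
    4 * p * glOrder q n p ≤ b * glOrder q n b := by
  have hlt : n / p < n / b := by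
    obtain ⟨m, rfl⟩ := hpn
    rw [Nat.mul_div_cancel_left m (by lia)]
    exact (Nat.lt_div_iff_mul_lt_of_dvd (by lia) hbn).2
      (by rw [mul_comm]; exact Nat.mul_lt_mul_of_pos_right hbp (by grind))
  obtain ⟨l, rfl⟩ : ∃ l, n = b * (l + 1) := by
    obtain ⟨_ | l, rfl⟩ := hbn
    · lia
    · exact ⟨l, rfl⟩
  set n := b * (l + 1) with hnl
  have hml : n / p ≤ l := by
    rw [hnl, Nat.mul_div_cancel_left _ (by lia)] at hlt
    lia
  have factor_le : glOrder q n p ≤ ∏ i ∈ Finset.range (n / p), (q ^ n - q ^ (b * i)) := by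
    refine Finset.prod_le_prod' fun i _ => Nat.sub_le_sub_left ?_ _
    exact Nat.pow_le_pow_right (by lia) (Nat.mul_le_mul_right i hbp.le)
  have le_factor : 4 * p ≤ b * (q ^ n - q ^ (b * l)) := by
    have hn_le : 2 * n ≤ 2 * q ^ (n - 1) := by
      have := Nat.lt_pow_self (n := n - 1) hq
      lia
    have hpow : 2 * q ^ (n - 1) ≤ q ^ n := by
      rw [← Nat.sub_add_cancel (show 1 ≤ n by lia), pow_succ', Nat.add_sub_cancel]
      exact Nat.mul_le_mul_right _ hq
    have hlast : q ^ (b * l) ≤ q ^ (n - 1) := Nat.pow_le_pow_right (by lia) (by grind)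
    calc 4 * p ≤ 2 * (q ^ n - q ^ (b * l)) := by lia
      _ ≤ b * (q ^ n - q ^ (b * l)) := Nat.mul_le_mul_right _ hb
  calc 4 * p * glOrder q n p
      ≤ b * (q ^ n - q ^ (b * l)) * ∏ i ∈ Finset.range (n / p), (q ^ n - q ^ (b * i)) :=
        Nat.mul_le_mul le_factor factor_le
    _ = b * ((∏ i ∈ Finset.range (n / p), (q ^ n - q ^ (b * i))) * (q ^ n - q ^ (b * l))) := by
        ring
    _ ≤ b * glOrder q n b := Nat.mul_le_mul_left _ (mul_sub_le_glOrder hq (by lia) hml)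

theorem sixteen_mul_sq_le_three_mul_four_pow {p : ℕ} (hp : 3 ≤ p) : 16 * p ^ 2 ≤ 3 * 4 ^ p := by
  induction p, hp using Nat.le_induction with
  | base => norm_num
  | succ p hp ih => rw [pow_succ 4]; nlinarith

theorem four_mul_sq_mul_pow_mul_glOrder_le {q n p : ℕ} (hq : 2 ≤ q) (hp : 3 ≤ p)
    (hn : 2 * p ≤ n) :
    4 * p ^ 2 * (q ^ n) ^ (n / 2) * glOrder q n p ≤ 3 * glOrder q n 1 := by
  have sq_le : 16 * p ^ 2 ≤ 3 * q ^ n :=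
    calc 16 * p ^ 2 ≤ 3 * 2 ^ (2 * p) := by
          rw [pow_mul]
          exact sixteen_mul_sq_le_three_mul_four_pow hp
      _ ≤ 3 * q ^ n := Nat.mul_le_mul_left 3 (pow_le_pow hq (by lia) hn)
  have div_add_div_lt : n / 2 + n / p < n := by
    have : n / p ≤ n / 3 := Nat.div_le_div_left hp (by norm_num)
    lia
  refine Nat.le_of_mul_le_mul_left (?_ : 4 * _ ≤ 4 * _) (by norm_num)
  calc 4 * (4 * p ^ 2 * (q ^ n) ^ (n / 2) * glOrder q n p)
      = 16 * p ^ 2 * ((q ^ n) ^ (n / 2) * glOrder q n p) := by ring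
    _ ≤ 3 * q ^ n * ((q ^ n) ^ (n / 2) * (q ^ n) ^ (n / p)) := by
        gcongr
        exact glOrder_le_pow q n p
    _ = 3 * (q ^ n) ^ (n / 2 + n / p + 1) := by ring
    _ ≤ 3 * (q ^ n) ^ n := by
        gcongr
        · exact Nat.one_le_pow _ _ (by lia)
        · exact div_add_div_lt
    _ ≤ 3 * (4 * glOrder q n 1) := Nat.mul_le_mul_left 3 (pow_pow_le_four_mul_glOrder_one hq n)
    _ = 4 * (3 * glOrder q n 1) := by ring

/-! ### Counting subspaces -/

section Subspaces

variable {F V : Type*} [Field F] [AddCommGroup V] [Module F V]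

theorem exists_span_range_eq_of_finrank_le [FiniteDimensional F V] {U : Submodule F V} {m : ℕ}
    (hU : finrank F U ≤ m) : ∃ v : Fin m → V, Submodule.span F (Set.range v) = U := by
  let B := finBasis F U
  let v : Fin (finrank F U) → V := fun i => B i
  have hv : Submodule.span F (Set.range v) = U := by
    rw [show v = U.subtype ∘ B from rfl, Set.range_comp, Submodule.span_image, B.span_eq,
      Submodule.map_top, Submodule.range_subtype]
  refine ⟨Function.extend (Fin.castLE hU) v 0, le_antisymm (Submodule.span_le.2 ?_) ?_⟩
  · rintro _ ⟨i, rfl⟩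
    by_cases hi : ∃ j, Fin.castLE hU j = i
    · obtain ⟨j, rfl⟩ := hi
      rw [(Fin.castLE_injective hU).extend_apply]
      exact (B j).2
    · rw [Function.extend_apply' _ _ _ hi]
      exact U.zero_mem
  · refine hv.ge.trans (Submodule.span_mono ?_)
    rintro _ ⟨j, rfl⟩
    exact ⟨_, (Fin.castLE_injective hU).extend_apply v 0 j⟩

variable [Finite V]

theorem card_submodule_finrank_le (m : ℕ) :
    Nat.card {U : Submodule F V // finrank F U ≤ m} ≤ (Nat.card F ^ finrank F V) ^ m := by
  have hcard : Nat.card (Fin m → V) = (Nat.card F ^ finrank F V) ^ m := by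
    rw [Nat.card_fun, Module.natCard_eq_pow_finrank (K := F), Nat.card_fin]
  choose v hv using fun U : {U : Submodule F V // finrank F U ≤ m} =>
    exists_span_range_eq_of_finrank_le U.2
  rw [← hcard]
  refine Nat.card_le_card_of_injective v fun U W h => Subtype.ext ?_
  rw [← hv U, ← hv W, h]

variable (F V) in
/-- The subspaces of dimension at most half that of `V` and not divisible by `b`. Their
stabilizers occur in the minimal cover of `End F V`. -/
noncomputable def smallSubspaces (b : ℕ) : Finset (Submodule F V) :=
  (Set.toFinite {U : Submodule F V | ¬ b ∣ finrank F U ∧ 2 * finrank F U ≤ finrank F V}).toFinset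

theorem mem_smallSubspaces {b : ℕ} {U : Submodule F V} :
    U ∈ smallSubspaces F V b ↔ ¬ b ∣ finrank F U ∧ 2 * finrank F U ≤ finrank F V := by
  simp [smallSubspaces]

theorem card_smallSubspaces_le (b : ℕ) :
    (smallSubspaces F V b).card ≤ (Nat.card F ^ finrank F V) ^ (finrank F V / 2) := by
  rw [smallSubspaces, ← Set.ncard_eq_toFinset_card]
  refine (Set.ncard_le_ncard fun U hU => ?_).trans (card_submodule_finrank_le _)
  exact (Nat.le_div_iff_mul_le two_pos).2 (mul_comm 2 (finrank F U) ▸ hU.2)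

variable [Finite F] {K L : Type*} [Field K] [Algebra F K] [FiniteDimensional F K] [Field L]
  [Algebra F L] [FiniteDimensional F L]

theorem card_algHom_end_eq_of_finrank_eq (h : finrank F K = finrank F L)
    (hL : finrank F L ∣ finrank F V) :
    Nat.card (K →ₐ[F] End F V) = Nat.card (L →ₐ[F] End F V) := by
  refine Nat.eq_of_mul_eq_mul_right (glOrder_pos (n := finrank F V) (d := finrank F L)
    (Finite.one_lt_card (α := F))) ?_
  rw [card_algHom_end_mul_glOrder hL, ← h]
  exact card_algHom_end_mul_glOrder (h ▸ hL)

theorem four_mul_mul_card_algHom_end_le (hL : 2 ≤ finrank F L) (hLK : finrank F L < finrank F K)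
    (hLV : finrank F L ∣ finrank F V) (hKV : finrank F K ∣ finrank F V)
    (hn : 2 * finrank F K ≤ finrank F V) :
    4 * finrank F K * Nat.card (L →ₐ[F] End F V) ≤
      finrank F L * Nat.card (K →ₐ[F] End F V) := by
  have hq : 2 ≤ Nat.card F := Finite.one_lt_card
  set q := Nat.card F
  set n := finrank F V
  refine Nat.le_of_mul_le_mul_right ?_ (glOrder_pos hq (n := n) (d := finrank F L))
  calc 4 * finrank F K * Nat.card (L →ₐ[F] End F V) * glOrder q n (finrank F L)
      = 4 * finrank F K * glOrder q n (finrank F K) * Nat.card (K →ₐ[F] End F V) := by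
        rw [mul_assoc, card_algHom_end_mul_glOrder hLV, ← card_algHom_end_mul_glOrder hKV]
        ring
    _ ≤ finrank F L * glOrder q n (finrank F L) * Nat.card (K →ₐ[F] End F V) :=
        Nat.mul_le_mul_right _ (four_mul_mul_glOrder_le hq hL hLK hLV hKV hn)
    _ = finrank F L * Nat.card (K →ₐ[F] End F V) * glOrder q n (finrank F L) := by ring

theorem four_mul_sq_mul_card_smallSubspaces_le {b : ℕ} (hK : 3 ≤ finrank F K)
    (hKV : finrank F K ∣ finrank F V) (hn : 2 * finrank F K ≤ finrank F V) :
    4 * finrank F K ^ 2 * (smallSubspaces F V b).card ≤ 3 * Nat.card (K →ₐ[F] End F V) := by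
  have hq : 2 ≤ Nat.card F := Finite.one_lt_card
  refine (Nat.mul_le_mul_left _ (card_smallSubspaces_le b)).trans ?_
  refine Nat.le_of_mul_le_mul_right ?_ (glOrder_pos hq (n := finrank F V) (d := finrank F K))
  rw [mul_assoc 3, card_algHom_end_mul_glOrder hKV]
  exact four_mul_sq_mul_pow_mul_glOrder_le hq hK hn

end Subspaces

/-! ### The lower bound -/

section LowerBound

variable {F V : Type*} [Field F] [AddCommGroup V] [Module F V]

/-- The number of conjugates of `x` in `A`, counted with the conjugating automorphisms. -/
noncomputable def conjCount (x : End F V) (A : NonUnitalSubring (End F V)) : ℕ :=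
  Nat.card {g : V ≃ₗ[F] V // g.conjAlgEquiv F x ∈ A}

variable {x : End F V} {k r : ℕ} {A : NonUnitalSubring (End F V)} {U : Submodule F V}
  {K : Type} [Field K] [Algebra F K] {φ : K →ₐ[F] End F V}

theorem exists_conj_mem_of_conjCount_ne_zero (h : conjCount x A ≠ 0) :
    ∃ g : V ≃ₗ[F] V, g.conjAlgEquiv F x ∈ A :=
  nonempty_subtype.1 (Nat.card_ne_zero.1 h).1

theorem inv_smul_mem_invtSubmodule {g : V ≃ₗ[F] V}
    (h : U ∈ End.invtSubmodule (g.conjAlgEquiv F x)) : g⁻¹ • U ∈ End.invtSubmodule x :=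
  (LinearEquiv.map_mem_invtSubmodule_iff (e := g⁻¹)).2 h

theorem commute_inv_smul {g : V ≃ₗ[F] V} {a : K} (h : Commute (φ a) (g.conjAlgEquiv F x)) :
    Commute ((g⁻¹ • φ) a) x := by
  have := h.map (g.symm.conjAlgEquiv F)
  rwa [show g.symm.conjAlgEquiv F (g.conjAlgEquiv F x) = x by ext; simp] at this

namespace IsTestElement

variable (hx : IsTestElement x k r)
include hx

theorem algebraMap_mem_of_conjCount_ne_zero (h : conjCount x A ≠ 0) (c : F) :
    algebraMap F (End F V) c ∈ A := by
  obtain ⟨g, hg⟩ := exists_conj_mem_of_conjCount_ne_zero h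
  exact (g.conjAlgEquiv F).commutes c ▸
    hx.algebraMap_mem (A.comap (g.conjAlgEquiv F : End F V →ₙ+* End F V)) hg c

theorem finrank_eq_of_conjCount_ne_zero (hU : ∀ a ∈ A, U ∈ End.invtSubmodule a) (hbot : U ≠ ⊥)
    (htop : U ≠ ⊤) (h : conjCount x A ≠ 0) : finrank F U = k ∨ finrank F U + k = finrank F V := by
  obtain ⟨g, hg⟩ := exists_conj_mem_of_conjCount_ne_zero h
  have := hx.finrank_eq (g⁻¹ • U) (inv_smul_mem_invtSubmodule (hU _ hg))
    ((Submodule.map_ne_bot_iff (e := g⁻¹)).2 hbot) ((Submodule.map_ne_top_iff (e := g⁻¹)).2 htop)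
  rwa [show finrank F ↥(g⁻¹ • U) = finrank F U from LinearEquiv.finrank_map_eq g⁻¹ U] at this

theorem dvd_of_conjCount_ne_zero [FiniteDimensional F K] (hφ : ∀ a ∈ A, ∀ c, Commute (φ c) a)
    (h : conjCount x A ≠ 0) : finrank F K ∣ k := by
  obtain ⟨g, hg⟩ := exists_conj_mem_of_conjCount_ne_zero h
  exact hx.dvd_of_commute K (g⁻¹ • φ) fun c => commute_inv_smul (hφ _ hg c)

variable [Finite V]

/-- The automorphisms counted by `conjCount x A` carry one and the same subspace to `U`. -/
theorem conjCount_mul_card_le_of_invtSubmodule (hU : ∀ a ∈ A, U ∈ End.invtSubmodule a) :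
    conjCount x A * Nat.card {X : Submodule F V // finrank F X = finrank F U} ≤
      Nat.card (V ≃ₗ[F] V) := by
  rcases eq_or_ne (conjCount x A) 0 with h | h
  · simp [h]
  obtain ⟨g₀, hg₀⟩ := exists_conj_mem_of_conjCount_ne_zero h
  have hdim (g : V ≃ₗ[F] V) : finrank F ↥(g⁻¹ • U) = finrank F U :=
    LinearEquiv.finrank_map_eq g⁻¹ U
  have hsmul (g : V ≃ₗ[F] V) (hg : g.conjAlgEquiv F x ∈ A) : g • g₀⁻¹ • U = U := by
    rw [hx.eq_of_finrank_eq _ (inv_smul_mem_invtSubmodule (hU _ hg₀)) _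
      (inv_smul_mem_invtSubmodule (hU _ hg)) ((hdim g₀).trans (hdim g).symm), smul_inv_smul]
  rw [← card_smul_submodule_eq_mul (hdim g₀), hdim]
  exact Nat.mul_le_mul_right _ (Nat.card_le_card_of_injective _
    (Subtype.map_injective hsmul Function.injective_id))

/-- Conjugating back, an automorphism counted by `conjCount x A` carries to `φ` one of the few
representations commuting with `x`. -/
theorem conjCount_mul_card_le_of_commute [Finite F] [FiniteDimensional F K]
    (hφ : ∀ a ∈ A, ∀ c, Commute (φ c) a) :
    conjCount x A * Nat.card (K →ₐ[F] End F V) ≤ finrank F K ^ r * Nat.card (V ≃ₗ[F] V) := by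
  let C := {ψ : K →ₐ[F] End F V // ∀ c, Commute (ψ c) x}
  have : Fintype C := Fintype.ofFinite C
  have hle : conjCount x A ≤ Nat.card (Σ ψ : C, {g : V ≃ₗ[F] V // g • ψ.1 = φ}) :=
    Nat.card_le_card_of_injective
      (fun g => ⟨⟨g.1⁻¹ • φ, fun c => commute_inv_smul (hφ _ g.2 c)⟩, g.1, smul_inv_smul _ _⟩)
      fun g h hgh => Subtype.ext
        (congrArg (fun s : Σ ψ : C, {g : V ≃ₗ[F] V // g • ψ.1 = φ} => s.2.1) hgh)
  calc conjCount x A * Nat.card (K →ₐ[F] End F V)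
      ≤ (∑ ψ : C, Nat.card {g : V ≃ₗ[F] V // g • ψ.1 = φ}) * Nat.card (K →ₐ[F] End F V) :=
        Nat.mul_le_mul_right _ (hle.trans_eq Nat.card_sigma)
    _ = Nat.card C * Nat.card (V ≃ₗ[F] V) := by
        rw [Finset.sum_mul, Finset.sum_congr rfl fun ψ _ => card_smul_algHom_eq_mul ψ.1 φ,
          Finset.sum_const, Finset.card_univ, smul_eq_mul, Nat.card_eq_fintype_card (α := C)]
    _ ≤ finrank F K ^ r * Nat.card (V ≃ₗ[F] V) :=
        Nat.mul_le_mul_right _ (hx.card_commute_le K)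

end IsTestElement

variable [Finite V] {x : ℕ → End F V} {b : ℕ}

theorem sum_conjCount_le_of_invtSubmodule
    (hx : ∀ W ∈ smallSubspaces F V b, IsTestElement (x (finrank F W)) (finrank F W) r)
    (hU : ∀ a ∈ A, U ∈ End.invtSubmodule a) (hbot : U ≠ ⊥) (htop : U ≠ ⊤) :
    ∑ W ∈ smallSubspaces F V b, conjCount (x (finrank F W)) A ≤ Nat.card (V ≃ₗ[F] V) := by
  classical
  set l := min (finrank F U) (finrank F V - finrank F U)
  have hUV : finrank F U ≤ finrank F V := Submodule.finrank_le U
  have finrank_eq {W : Submodule F V} (hW : W ∈ smallSubspaces F V b)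
      (h : conjCount (x (finrank F W)) A ≠ 0) : finrank F W = l := by
    have := (hx W hW).finrank_eq_of_conjCount_ne_zero hU hbot htop h
    have := (mem_smallSubspaces.1 hW).2
    lia
  by_cases hW₀ : ∃ W₀ ∈ smallSubspaces F V b, finrank F W₀ = l
  · obtain ⟨W₀, hW₀, hl⟩ := hW₀
    have hcard : Nat.card {X : Submodule F V // finrank F X = l} =
        Nat.card {X : Submodule F V // finrank F X = finrank F U} := by
      rcases min_choice (finrank F U) (finrank F V - finrank F U) with h | h
      · rw [show l = finrank F U from h]
      · exact card_submodule_finrank_eq_of_add_eq (by lia)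
    calc ∑ W ∈ smallSubspaces F V b, conjCount (x (finrank F W)) A
        ≤ ∑ W ∈ (Set.toFinite {X : Submodule F V | finrank F X = l}).toFinset,
            conjCount (x (finrank F W)) A :=
          Finset.sum_le_sum_of_ne_zero fun W hW h => by simpa using finrank_eq hW h
      _ = Nat.card {X : Submodule F V // finrank F X = l} * conjCount (x l) A := by
          rw [Finset.sum_congr rfl fun W hW => by rw [show finrank F W = l by simpa using hW],
            Finset.sum_const, smul_eq_mul, ← Set.ncard_eq_toFinset_card]
          rfl
      _ ≤ Nat.card (V ≃ₗ[F] V) := by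
          rw [mul_comm, hcard, ← hl]
          exact (hx W₀ hW₀).conjCount_mul_card_le_of_invtSubmodule hU
  · rw [Finset.sum_eq_zero fun W hW => not_imp_comm.1 (finrank_eq hW) fun h => hW₀ ⟨W, hW, h⟩]
    exact Nat.zero_le _

variable [Finite F] {L : Type*} [Field L] [Algebra F L] [FiniteDimensional F K]
  [FiniteDimensional F L]

theorem sum_conjCount_mul_card_le_of_commute
    (hx : ∀ W ∈ smallSubspaces F V b, IsTestElement (x (finrank F W)) (finrank F W) 2)
    (hφ : ∀ a ∈ A, ∀ c, Commute (φ c) a) :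
    (∑ W ∈ smallSubspaces F V b, conjCount (x (finrank F W)) A) * Nat.card (K →ₐ[F] End F V) ≤
      (smallSubspaces F V b).card * (finrank F K ^ 2 * Nat.card (V ≃ₗ[F] V)) := by
  rw [Finset.sum_mul]
  exact Finset.sum_le_card_nsmul _ _ _ fun W hW => (hx W hW).conjCount_mul_card_le_of_commute hφ

/-- When `finrank F L < finrank F K`, the two summands contribute at most a quarter and three
quarters of the bound. -/
theorem weight_le_of_commute [Nontrivial V] {y : End F V} (hy : IsTestElement y 0 1)
    (hx : ∀ W ∈ smallSubspaces F V (finrank F L),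
      IsTestElement (x (finrank F W)) (finrank F W) 2)
    (hL : IsLeast {p : ℕ | p.Prime ∧ p ∣ finrank F V} (finrank F L))
    (hK : (finrank F K).Prime) (hφ : ∀ a ∈ A, ∀ c, Commute (φ c) a) :
    Nat.card (L →ₐ[F] End F V) * conjCount y A + finrank F L *
        ∑ W ∈ smallSubspaces F V (finrank F L), conjCount (x (finrank F W)) A ≤
      finrank F L * Nat.card (V ≃ₗ[F] V) := by
  have hKV : finrank F K ∣ finrank F V := nonempty_algHom_end_iff.1 ⟨φ⟩
  have hyφ := hy.conjCount_mul_card_le_of_commute hφ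
  have hxφ := sum_conjCount_mul_card_le_of_commute hx hφ
  rw [pow_one] at hyφ
  rcases (hL.2 ⟨hK, hKV⟩).eq_or_lt with heq | hlt
  · rw [Finset.sum_eq_zero fun W hW => not_imp_comm.1
      ((hx W hW).dvd_of_conjCount_ne_zero hφ) (heq ▸ (mem_smallSubspaces.1 hW).1), mul_zero,
      add_zero, ← card_algHom_end_eq_of_finrank_eq heq.symm hL.1.2, heq, mul_comm]
    exact hyφ
  have hn : 2 * finrank F K ≤ finrank F V :=
    (Nat.mul_le_mul_right _ hL.1.1.two_le).trans <| Nat.le_of_dvd finrank_pos <|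
      ((Nat.coprime_primes hL.1.1 hK).2 hlt.ne).mul_dvd_of_dvd_of_dvd hL.1.2 hKV
  have hquarter := four_mul_mul_card_algHom_end_le (V := V) hL.1.1.two_le hlt hL.1.2 hKV hn
  have hthree := four_mul_sq_mul_card_smallSubspaces_le (V := V) (b := finrank F L)
    (hL.1.1.two_le.trans_lt hlt) hKV hn
  have hpos : 0 < Nat.card (K →ₐ[F] End F V) := Nat.card_pos_iff.2 ⟨⟨φ⟩, inferInstance⟩
  set S := ∑ W ∈ smallSubspaces F V (finrank F L), conjCount (x (finrank F W)) A
  set G := Nat.card (V ≃ₗ[F] V)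
  set p := finrank F K
  set b := finrank F L
  set T := (smallSubspaces F V b).card
  set Φp := Nat.card (K →ₐ[F] End F V)
  set Φb := Nat.card (L →ₐ[F] End F V)
  refine Nat.le_of_mul_le_mul_left ?_ (Nat.mul_pos four_pos hpos)
  calc 4 * Φp * (Φb * conjCount y A + b * S)
      = 4 * Φb * (conjCount y A * Φp) + 4 * b * (S * Φp) := by ring
    _ ≤ 4 * Φb * (p * G) + 4 * b * (T * (p ^ 2 * G)) := by gcongr
    _ = 4 * p * Φb * G + 4 * p ^ 2 * T * (b * G) := by ring
    _ ≤ b * Φp * G + 3 * Φp * (b * G) := by gcongr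
    _ = 4 * Φp * (b * G) := by ring

theorem weight_le_of_ne_top [Nontrivial V] {y : End F V} (hy : IsTestElement y 0 1)
    (hx : ∀ W ∈ smallSubspaces F V (finrank F L),
      IsTestElement (x (finrank F W)) (finrank F W) 2)
    (hL : IsLeast {p : ℕ | p.Prime ∧ p ∣ finrank F V} (finrank F L)) (hA : A ≠ ⊤) :
    Nat.card (L →ₐ[F] End F V) * conjCount y A + finrank F L *
        ∑ W ∈ smallSubspaces F V (finrank F L), conjCount (x (finrank F W)) A ≤
      finrank F L * Nat.card (V ≃ₗ[F] V) := by
  by_cases hscalar : ∀ c : F, algebraMap F (End F V) c ∈ A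
  · let S : Subalgebra F (End F V) :=
      { A with
        one_mem' := by simpa using hscalar 1
        algebraMap_mem' := hscalar }
    have hS : S ≠ ⊤ := fun h => hA (eq_top_iff.2 fun a _ => show a ∈ S from h ▸ trivial)
    rcases exists_invtSubmodule_or_exists_commute hS with
      ⟨U, hbot, htop, hU⟩ | ⟨K, _, _, φ, hK, hφ⟩
    · have hy₀ : conjCount y A = 0 := by
        by_contra h
        have hpos : finrank F U ≠ 0 := mt Submodule.finrank_eq_zero.1 hbot
        have hlt : finrank F U < finrank F V := Submodule.finrank_lt htop
        have := hy.finrank_eq_of_conjCount_ne_zero hU hbot htop h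
        lia
      rw [hy₀, mul_zero, zero_add]
      exact Nat.mul_le_mul_left _ (sum_conjCount_le_of_invtSubmodule hx hU hbot htop)
    · have : FiniteDimensional F K := FiniteDimensional.of_finrank_pos hK.pos
      exact weight_le_of_commute hy hx hL hK hφ
  · rw [Finset.sum_eq_zero fun W hW => not_imp_comm.1
        (hx W hW).algebraMap_mem_of_conjCount_ne_zero hscalar,
      not_imp_comm.1 hy.algebraMap_mem_of_conjCount_ne_zero hscalar]
    simp

omit [Finite F] in
theorem card_le_sum_conjCount (y : End F V) {C : Finset (NonUnitalSubring (End F V))}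
    (hC : ∀ z, ∃ A ∈ C, z ∈ A) : Nat.card (V ≃ₗ[F] V) ≤ ∑ A ∈ C, conjCount y A := by
  choose f hf hmem using hC
  rw [← Finset.sum_coe_sort]
  refine (Nat.card_le_card_of_injective
    (β := Σ A : C, {g : V ≃ₗ[F] V // g.conjAlgEquiv F y ∈ A.1})
    (fun g => ⟨⟨f (g.conjAlgEquiv F y), hf _⟩, g, hmem _⟩) fun g h hgh => ?_).trans_eq
    Nat.card_sigma
  exact congrArg (fun s : Σ A : C, {g : V ≃ₗ[F] V // g.conjAlgEquiv F y ∈ A.1} => s.2.1) hgh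

theorem IsProperSubringCover.card_algHom_add_le [Nontrivial V]
    {C : Finset (NonUnitalSubring (End F V))} (hC : IsProperSubringCover C)
    (hL : IsLeast {p : ℕ | p.Prime ∧ p ∣ finrank F V} (finrank F L)) :
    Nat.card (L →ₐ[F] End F V) + finrank F L * (smallSubspaces F V (finrank F L)).card ≤
      finrank F L * C.card := by
  obtain ⟨y, hy⟩ := exists_isTestElement_zero (F := F) (V := V) finrank_pos.ne'
  have hx (k : ℕ) : ∃ x : End F V, 0 < k → 2 * k ≤ finrank F V → IsTestElement x k 2 := by
    by_cases hk : 0 < k ∧ 2 * k ≤ finrank F V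
    · obtain ⟨x, hx⟩ := exists_isTestElement hk.1 hk.2
      exact ⟨x, fun _ _ => hx⟩
    · exact ⟨0, fun h₁ h₂ => absurd ⟨h₁, h₂⟩ hk⟩
  choose x hx using hx
  set b := finrank F L
  set T := smallSubspaces F V b
  have hxT (W : Submodule F V) (hW : W ∈ T) :
      IsTestElement (x (finrank F W)) (finrank F W) 2 := by
    obtain ⟨hdvd, hle⟩ := mem_smallSubspaces.1 hW
    exact hx _ (Nat.pos_of_ne_zero fun h => hdvd (h ▸ dvd_zero b)) hle
  set G := Nat.card (V ≃ₗ[F] V)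
  set Φ := Nat.card (L →ₐ[F] End F V)
  have cover (z : End F V) : G ≤ ∑ A ∈ C, conjCount z A := card_le_sum_conjCount z hC.2
  refine Nat.le_of_mul_le_mul_right ?_ (Nat.card_pos : 0 < G)
  calc (Φ + b * T.card) * G = Φ * G + b * ∑ _W ∈ T, G := by
        rw [Finset.sum_const, smul_eq_mul]
        ring
    _ ≤ Φ * ∑ A ∈ C, conjCount y A + b * ∑ W ∈ T, ∑ A ∈ C, conjCount (x (finrank F W)) A := by
        gcongr
        exacts [cover y, cover _]
    _ = ∑ A ∈ C, (Φ * conjCount y A + b * ∑ W ∈ T, conjCount (x (finrank F W)) A) := by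
        rw [Finset.sum_comm, Finset.mul_sum, Finset.mul_sum, Finset.sum_add_distrib]
    _ ≤ ∑ _A ∈ C, b * G := Finset.sum_le_sum fun A hA => weight_le_of_ne_top hy hxT hL (hC.1 A hA)
    _ = b * C.card * G := by
        rw [Finset.sum_const, smul_eq_mul]
        ring

end LowerBound

/-! ### The upper bound -/

section FaithfulModule

variable {F A V : Type*} [CommRing A] [AddCommGroup V] [Module A V]

theorem exists_ne_zero_smul_eq_zero [IsArtinianRing A] [FaithfulSMul A V] {a : A}
    (ha : ¬ IsUnit a) : ∃ v : V, v ≠ 0 ∧ a • v = 0 := by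
  have ha' : a ∉ nonZeroDivisors A := mt IsArtinianRing.isUnit_of_mem_nonZeroDivisors ha
  obtain ⟨c, hca, hc⟩ : ∃ c, c * a = 0 ∧ c ≠ 0 := by
    simpa [mem_nonZeroDivisors_iff_right] using ha'
  obtain ⟨v, hv⟩ : ∃ v : V, c • v ≠ 0 := by
    by_contra! h
    exact hc (FaithfulSMul.eq_of_smul_eq_smul (α := V) fun v => by rw [h, zero_smul])
  exact ⟨c • v, hv, by rw [smul_smul, mul_comm, hca, zero_smul]⟩

section Maximal

variable {M : Ideal A} [hM : M.IsMaximal] {v w : V}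

theorem nonempty_quotient_linearEquiv_span_singleton (hv : v ≠ 0) (hMv : ∀ a ∈ M, a • v = 0) :
    Nonempty ((A ⧸ M) ≃ₗ[A] Submodule.span A {v}) := by
  have hM_eq : M = Ideal.torsionOf A V v :=
    hM.eq_of_le (fun h => hv ((Ideal.torsionOf_eq_top_iff A v).1 h)) hMv
  exact hM_eq ▸ ⟨Ideal.quotTorsionOfEquivSpanSingleton A V v⟩

theorem isAtom_span_singleton (hv : v ≠ 0) (hMv : ∀ a ∈ M, a • v = 0) :
    IsAtom (Submodule.span A {v}) := by
  obtain ⟨e⟩ := nonempty_quotient_linearEquiv_span_singleton hv hMv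
  exact isSimpleModule_iff_isAtom.1 <| e.isSimpleModule_iff.1 <|
    (isSimpleModule_iff_isCoatom ..).2 hM.out

variable (F) [Field F] [Algebra F A] [Module F V] [IsScalarTower F A V]

theorem finrank_quotient_eq_finrank_span_singleton (hv : v ≠ 0) (hMv : ∀ a ∈ M, a • v = 0) :
    finrank F (A ⧸ M) = finrank F (Submodule.span A {v}) := by
  obtain ⟨e⟩ := nonempty_quotient_linearEquiv_span_singleton hv hMv
  exact (e.restrictScalars F).finrank_eq

theorem two_mul_finrank_quotient_le [FiniteDimensional F V] (hv : v ≠ 0)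
    (hMv : ∀ a ∈ M, a • v = 0) (hMw : ∀ a ∈ M, a • w = 0) (hwv : w ∉ Submodule.span A {v}) :
    2 * finrank F (A ⧸ M) ≤ finrank F V := by
  have hw : w ≠ 0 := fun h => hwv (h ▸ Submodule.zero_mem _)
  have hdisj : Disjoint (Submodule.span A {v}) (Submodule.span A {w}) :=
    (isAtom_span_singleton hv hMv).disjoint_of_ne (isAtom_span_singleton hw hMw) fun h =>
      hwv (h ▸ Submodule.mem_span_singleton_self w)
  calc 2 * finrank F (A ⧸ M)
      = finrank F (Submodule.span A {v}) + finrank F (Submodule.span A {w}) := by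
        rw [← finrank_quotient_eq_finrank_span_singleton F hv hMv,
          ← finrank_quotient_eq_finrank_span_singleton F hw hMw, two_mul]
    _ ≤ finrank F V := Submodule.finrank_add_finrank_le_of_disjoint
        (s := (Submodule.span A {v}).restrictScalars F)
        (t := (Submodule.span A {w}).restrictScalars F)
        (Submodule.disjoint_def.2 fun _ hx hy => Submodule.disjoint_def.1 hdisj _ hx hy)

end Maximal

/-- Let `M = (a)`. The kernel of `a` is a nonzero space over `A ⧸ M`. If it is a line, then the
range of `a` has codimension `finrank F (A ⧸ M)`; otherwise it contains two independent lines, so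
that the dimension of a line is at most half that of `V`. -/
theorem dvd_finrank_quotient_of_forall_dvd_finrank [IsPrincipalIdealRing A] [IsArtinianRing A]
    [FaithfulSMul A V] [Field F] [Algebra F A] [Module F V] [IsScalarTower F A V]
    [FiniteDimensional F V] {b : ℕ} (hb : b ∣ finrank F V)
    (hU : ∀ U : Submodule A V, 2 * finrank F U ≤ finrank F V → b ∣ finrank F U)
    (M : Ideal A) [hM : M.IsMaximal] : b ∣ finrank F (A ⧸ M) := by
  obtain ⟨a, hMa⟩ := (IsPrincipalIdealRing.principal M).principal
  let f : V →ₗ[A] V := LinearMap.lsmul A V a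
  have smul_eq_zero_of_mem_ker {w : V} (hw : w ∈ f.ker) : ∀ r ∈ M, r • w = 0 := fun r hr => by
    obtain ⟨s, rfl⟩ := Ideal.mem_span_singleton'.1 (hMa ▸ hr)
    rw [mul_smul, show a • w = 0 from hw, smul_zero]
  obtain ⟨v, hv0, hv⟩ : ∃ v : V, v ≠ 0 ∧ v ∈ f.ker :=
    exists_ne_zero_smul_eq_zero fun ha => hM.ne_top (Ideal.span_singleton_eq_top.2 ha ▸ hMa)
  have hMv := smul_eq_zero_of_mem_ker hv
  have hline := finrank_quotient_eq_finrank_span_singleton F hv0 hMv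
  by_cases hd : 2 * finrank F (A ⧸ M) ≤ finrank F V
  · rw [hline] at hd ⊢
    exact hU _ hd
  have hker : f.ker = Submodule.span A {v} := by
    refine le_antisymm (fun w hw => ?_) (Submodule.span_le.2 (Set.singleton_subset_iff.2 hv))
    exact by_contra fun hwv =>
      hd (two_mul_finrank_quotient_le F hv0 hMv (smul_eq_zero_of_mem_ker hw) hwv)
  have rank_nullity : finrank F f.range + finrank F (A ⧸ M) = finrank F V := by
    rw [hline, ← hker]
    exact (f.restrictScalars F).finrank_range_add_finrank_ker
  have hrange : b ∣ finrank F f.range := hU _ (by lia)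
  exact (Nat.dvd_add_right hrange).1 (rank_nullity ▸ hb)

end FaithfulModule

section

variable {F : Type*} [Field F] [Finite F] {A K : Type*} [CommRing A] [Algebra F A]
  [FiniteDimensional F A] [Field K] [Algebra F K] [FiniteDimensional F K]

/-- `K` embeds in the residue fields of `A`, hence in the reduction of `A`; since it is separable
over `F`, the embedding lifts to `A`. -/
theorem nonempty_algHom_of_forall_finrank_dvd
    (h : ∀ M : Ideal A, M.IsMaximal → finrank F K ∣ finrank F (A ⧸ M)) :
    Nonempty (K →ₐ[F] A) := by
  have : IsArtinianRing A := IsArtinianRing.of_finite F A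
  have : Finite A := Module.finite_of_finite F
  have : Finite K := Module.finite_of_finite F
  have residue (M : MaximalSpectrum A) : Nonempty (K →ₐ[F] A ⧸ M.asIdeal) := by
    let _ : Field (A ⧸ M.asIdeal) := Ideal.Quotient.field M.asIdeal
    have : Finite (A ⧸ M.asIdeal) := Finite.of_surjective _ Ideal.Quotient.mk_surjective
    exact FiniteField.nonempty_algHom_of_finrank_dvd (h _ M.isMaximal)
  have : Algebra.FormallyEtale F K := Algebra.FormallyEtale.of_isSeparable F K
  let e : (A ⧸ nilradical A) ≃ₐ[F] ∀ M : MaximalSpectrum A, A ⧸ M.asIdeal :=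
    (IsArtinianRing.quotNilradicalEquivPi A).restrictScalars F
  let f : K →ₐ[F] A ⧸ nilradical A :=
    (e.symm : _ →ₐ[F] A ⧸ nilradical A).comp (AlgHom.pi fun M => (residue M).some)
  exact ⟨Algebra.FormallySmooth.lift (nilradical A) IsArtinianRing.isNilpotent_nilradical f⟩

end

section Cover

variable {F V K : Type*} [Field F] [AddCommGroup V] [Module F V] [Field K] [Algebra F K]

theorem isPrincipalIdealRing_adjoin_singleton {B : Type*} [Ring B] [Algebra F B] (x : B) :
    IsPrincipalIdealRing (Algebra.adjoin F {x}) := by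
  rw [Algebra.adjoin_singleton_eq_range_aeval]
  exact IsPrincipalIdealRing.of_surjective _ (Polynomial.aeval x).rangeRestrict_surjective

theorem exists_invtSubmodule_or_exists_commute_algHom [Finite F] [Finite V]
    [FiniteDimensional F K] (hK : finrank F K ∣ finrank F V) (x : End F V) :
    (∃ U ∈ smallSubspaces F V (finrank F K), U ∈ End.invtSubmodule x) ∨
      ∃ φ : K →ₐ[F] End F V, ∀ a, Commute (φ a) x := by
  by_contra! ⟨no_subspace, no_field⟩
  let A := Algebra.adjoin F {x}
  let x' : A := ⟨x, Algebra.self_mem_adjoin_singleton F x⟩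
  have : IsPrincipalIdealRing A := isPrincipalIdealRing_adjoin_singleton x
  have : IsArtinianRing A := IsArtinianRing.of_finite F A
  obtain ⟨f⟩ := nonempty_algHom_of_forall_finrank_dvd (K := K) (A := A) fun M _ =>
    dvd_finrank_quotient_of_forall_dvd_finrank (V := V) hK
      (fun U hU => by
        by_contra hnd
        exact no_subspace (U.restrictScalars F) (mem_smallSubspaces.2 ⟨hnd, hU⟩)
          fun u hu => U.smul_mem x' hu) M
  obtain ⟨a, ha⟩ := no_field (A.val.comp f)
  exact ha ((Commute.all (f a) x').map A.val)

theorem stabilizerSubring_ne_top {U : Submodule F V} (hbot : U ≠ ⊥) (htop : U ≠ ⊤) :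
    stabilizerSubring U ≠ ⊤ := by
  intro h
  obtain ⟨u, hu, hu0⟩ := U.exists_mem_ne_zero_of_ne_bot hbot
  obtain ⟨w, hw⟩ := SetLike.exists_not_mem_of_ne_top U htop rfl
  obtain ⟨f, hf⟩ := Projective.exists_dual_ne_zero F hu0
  have hmem : f.smulRight w ∈ stabilizerSubring U := h ▸ trivial
  exact hw ((U.smul_mem_iff hf).1 (hmem hu))

/-- The subring of the endomorphisms commuting with the image of `φ`. -/
def centralizerSubring (φ : K →ₐ[F] End F V) : NonUnitalSubring (End F V) :=
  NonUnitalSubring.centralizer (Set.range φ)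

theorem mem_centralizerSubring {φ : K →ₐ[F] End F V} {x : End F V} :
    x ∈ centralizerSubring φ ↔ ∀ a, Commute (φ a) x := by
  simp [centralizerSubring, NonUnitalSubring.mem_centralizer_iff, Commute, SemiconjBy]

theorem centralizerSubring_ne_top [Nontrivial V] (hK : 1 < finrank F K) (φ : K →ₐ[F] End F V) :
    centralizerSubring φ ≠ ⊤ := by
  intro h
  have central : φ.range ≤ ⊥ := by
    rw [← Algebra.IsCentral.center_eq_bot F (End F V)]
    rintro _ ⟨a, rfl⟩
    exact Subalgebra.mem_center_iff.2 fun x =>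
      (mem_centralizerSubring.1 (h ▸ trivial : x ∈ centralizerSubring φ) a).eq.symm
  have := (AlgEquiv.ofInjective φ φ.toRingHom.injective).toLinearEquiv.finrank_eq
  rw [le_bot_iff.1 central, Subalgebra.finrank_bot] at this
  exact hK.ne' this

theorem finrank_mul_ncard_range_centralizerSubring_le [Finite F] [Finite V] [Nontrivial V]
    [FiniteDimensional F K] :
    finrank F K * (Set.range (centralizerSubring (F := F) (V := V) (K := K))).ncard ≤
      Nat.card (K →ₐ[F] End F V) := by
  classical
  have := Fintype.ofFinite (K →ₐ[F] End F V)
  have : Finite K := Module.finite_of_finite F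
  rw [← Set.image_univ, ← Finset.coe_univ, ← Finset.coe_image, Set.ncard_coe_finset,
    Nat.card_eq_fintype_card, ← Finset.card_univ]
  refine Finset.mul_card_image_le_card _ _ fun S hS => ?_
  obtain ⟨φ, -, rfl⟩ := Finset.mem_image.1 hS
  have twist_injective : Function.Injective fun σ : K ≃ₐ[F] K => φ.comp (σ : K →ₐ[F] K) :=
    fun σ τ h => AlgEquiv.ext fun a => φ.toRingHom.injective (DFunLike.congr_fun h a)
  rw [← IsGalois.card_aut_eq_finrank F K, Nat.card_eq_fintype_card, ← Finset.card_univ,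
    ← Finset.card_image_of_injective _ twist_injective]
  refine Finset.card_le_card fun ψ hψ => ?_
  obtain ⟨σ, -, rfl⟩ := Finset.mem_image.1 hψ
  have : Set.range (φ.comp (σ : K →ₐ[F] K)) = Set.range φ := σ.surjective.range_comp φ
  rw [Finset.mem_filter, centralizerSubring, this, centralizerSubring]
  exact ⟨Finset.mem_univ _, rfl⟩

theorem exists_isProperSubringCover_finrank_mul_card_le [Finite F] [Finite V] [Nontrivial V]
    [FiniteDimensional F K] (hK : 1 < finrank F K) (hKV : finrank F K ∣ finrank F V) :
    ∃ C : Finset (NonUnitalSubring (End F V)), IsProperSubringCover C ∧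
      finrank F K * C.card ≤
        Nat.card (K →ₐ[F] End F V) + finrank F K * (smallSubspaces F V (finrank F K)).card := by
  classical
  let stabilizers := (smallSubspaces F V (finrank F K)).image stabilizerSubring
  let centralizers := (Set.finite_range (centralizerSubring (F := F) (V := V) (K := K))).toFinset
  refine ⟨stabilizers ∪ centralizers, ⟨fun S hS => ?_, fun x => ?_⟩, ?_⟩
  · rcases Finset.mem_union.1 hS with hS | hS
    · obtain ⟨U, hU, rfl⟩ := Finset.mem_image.1 hS
      have hU := (mem_smallSubspaces.1 hU).1
      refine stabilizerSubring_ne_top ?_ ?_ <;> rintro rfl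
      · exact hU (by simp)
      · exact hU (by rwa [finrank_top])
    · obtain ⟨φ, rfl⟩ := (Set.Finite.mem_toFinset _).1 hS
      exact centralizerSubring_ne_top hK φ
  · rcases exists_invtSubmodule_or_exists_commute_algHom hKV x with ⟨U, hU, hxU⟩ | ⟨φ, hφ⟩
    · exact ⟨_, Finset.mem_union_left _ (Finset.mem_image_of_mem _ hU), hxU⟩
    · exact ⟨_, Finset.mem_union_right _ ((Set.Finite.mem_toFinset _).2 ⟨φ, rfl⟩),
        mem_centralizerSubring.2 hφ⟩
  · have hcentralizers : finrank F K * centralizers.card ≤ Nat.card (K →ₐ[F] End F V) := by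
      rw [← Set.ncard_eq_toFinset_card]
      exact finrank_mul_ncard_range_centralizerSubring_le
    calc finrank F K * (stabilizers ∪ centralizers).card
        ≤ finrank F K * (stabilizers.card + centralizers.card) := by
          gcongr; exact Finset.card_union_le _ _
      _ = finrank F K * centralizers.card + finrank F K * stabilizers.card := by ring
      _ ≤ _ := by gcongr; exact Finset.card_image_le

end Cover

/-! ### The covering number -/

section RingEquiv

variable {R S : Type*} [NonUnitalRing R] [NonUnitalRing S]

theorem IsProperSubringCover.exists_of_ringEquiv {C : Finset (NonUnitalSubring R)}
    (hC : IsProperSubringCover C) (e : R ≃+* S) :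
    ∃ D : Finset (NonUnitalSubring S), IsProperSubringCover D ∧ D.card = C.card := by
  classical
  let f (A : NonUnitalSubring R) : NonUnitalSubring S := A.comap (e.symm : S →ₙ+* R)
  have mem_f (A : NonUnitalSubring R) (x : R) : e x ∈ f A ↔ x ∈ A := by
    simp [f, NonUnitalSubring.mem_comap]
  have f_injective : Function.Injective f := fun A B hAB =>
    SetLike.ext fun x => by rw [← mem_f A, ← mem_f B, hAB]
  refine ⟨C.image f, ⟨fun B hB => ?_, fun y => ?_⟩, Finset.card_image_of_injective _ f_injective⟩
  · obtain ⟨A, hA, rfl⟩ := Finset.mem_image.1 hB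
    exact fun h => hC.1 A hA (eq_top_iff.2 fun x _ => (mem_f A x).1 (h ▸ trivial))
  · obtain ⟨A, hA, hy⟩ := hC.2 (e.symm y)
    exact ⟨f A, Finset.mem_image_of_mem f hA, hy⟩

theorem IsProperlyCoverable.of_ringEquiv (h : IsProperlyCoverable R) (e : R ≃+* S) :
    IsProperlyCoverable S := by
  obtain ⟨C, hC⟩ := h
  obtain ⟨D, hD, -⟩ := hC.exists_of_ringEquiv e
  exact ⟨D, hD⟩

theorem coveringNumber_congr (e : R ≃+* S) : coveringNumber R = coveringNumber S := by
  unfold coveringNumber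
  congr 1
  ext k
  constructor <;> rintro ⟨C, hC, rfl⟩
  · exact hC.exists_of_ringEquiv e
  · exact hC.exists_of_ringEquiv e.symm

end RingEquiv

theorem prod_filter_dvd_eq_glOrder {d n : ℕ} (hd : 0 < d) (h : d ∣ n) (q : ℕ) :
    ∏ i ∈ Finset.range n with d ∣ i, (q ^ n - q ^ i) = glOrder q n d := by
  have filter_eq : (Finset.range n).filter (d ∣ ·) = (Finset.range (n / d)).image (d * ·) := by
    ext i
    simp only [Finset.mem_filter, Finset.mem_range, Finset.mem_image,
      Nat.lt_div_iff_mul_lt_of_dvd hd.ne' h]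
    constructor
    · rintro ⟨hi, j, rfl⟩
      exact ⟨j, by rwa [mul_comm], rfl⟩
    · rintro ⟨j, hj, rfl⟩
      exact ⟨by rwa [mul_comm], dvd_mul_right d j⟩
  rw [filter_eq, Finset.prod_image fun i _ j _ hij => Nat.eq_of_mul_eq_mul_left hd hij, glOrder]

theorem prod_filter_not_dvd_mul_glOrder {d n : ℕ} (hd : 0 < d) (h : d ∣ n) (q : ℕ) :
    (∏ i ∈ Finset.Icc 1 (n - 1) with ¬ d ∣ i, (q ^ n - q ^ i)) * glOrder q n d =
      glOrder q n 1 := by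
  have filter_eq : (Finset.Icc 1 (n - 1)).filter (¬ d ∣ ·) = (Finset.range n).filter (¬ d ∣ ·) := by
    ext i
    simp only [Finset.mem_filter, Finset.mem_range, Finset.mem_Icc]
    refine and_congr_left fun hi => ?_
    have : i ≠ 0 := fun h0 => hi (h0 ▸ dvd_zero d)
    lia
  rw [filter_eq, ← prod_filter_dvd_eq_glOrder hd h, mul_comm,
    Finset.prod_filter_mul_prod_filter_not, glOrder]
  simp only [Nat.div_one, one_mul]

section Main

variable {F V K : Type*} [Field F] [Finite F] [AddCommGroup V] [Module F V] [Finite V]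
  [Field K] [Algebra F K] [FiniteDimensional F K]

theorem isProperlyCoverable_end [Nontrivial V] (hK : 1 < finrank F K)
    (hKV : finrank F K ∣ finrank F V) : IsProperlyCoverable (End F V) := by
  obtain ⟨C, hC, -⟩ := exists_isProperSubringCover_finrank_mul_card_le hK hKV
  exact ⟨C, hC⟩

theorem finrank_mul_coveringNumber_end [Nontrivial V]
    (hK : IsLeast {p : ℕ | p.Prime ∧ p ∣ finrank F V} (finrank F K)) :
    finrank F K * coveringNumber (End F V) =
      Nat.card (K →ₐ[F] End F V) + finrank F K * (smallSubspaces F V (finrank F K)).card := by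
  obtain ⟨C, hC, hC_card⟩ :=
    exists_isProperSubringCover_finrank_mul_card_le hK.1.1.one_lt hK.1.2
  obtain ⟨D, hD, hD_card⟩ := Nat.sInf_mem (⟨_, C, hC, rfl⟩ :
    {k | ∃ C : Finset (NonUnitalSubring (End F V)), IsProperSubringCover C ∧ C.card = k}.Nonempty)
  refine le_antisymm (le_trans ?_ hC_card) ?_
  · exact Nat.mul_le_mul_left _ (Nat.sInf_le ⟨C, hC, rfl⟩)
  · rw [coveringNumber, ← hD_card]
    exact hD.card_algHom_add_le hK

theorem card_algHom_end_eq_prod (h : finrank F K ∣ finrank F V) :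
    Nat.card (K →ₐ[F] End F V) =
      ∏ i ∈ Finset.Icc 1 (finrank F V - 1) with ¬ finrank F K ∣ i,
        (Nat.card F ^ finrank F V - Nat.card F ^ i) := by
  refine Nat.eq_of_mul_eq_mul_right
    (glOrder_pos (q := Nat.card F) (n := finrank F V) (d := finrank F K) Finite.one_lt_card) ?_
  rw [card_algHom_end_mul_glOrder h, prod_filter_not_dvd_mul_glOrder finrank_pos h]

theorem cast_card_algHom_end_eq_prod (h : finrank F K ∣ finrank F V) :
    (Nat.card (K →ₐ[F] End F V) : ℚ) =
      ∏ i ∈ Finset.Icc 1 (finrank F V - 1) with ¬ finrank F K ∣ i,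
        ((Nat.card F : ℚ) ^ finrank F V - (Nat.card F : ℚ) ^ i) := by
  rw [card_algHom_end_eq_prod h, Nat.cast_prod]
  refine Finset.prod_congr rfl fun i hi => ?_
  have hi : i ≤ finrank F V := by
    have := Finset.mem_Icc.1 (Finset.mem_filter.1 hi).1
    lia
  rw [Nat.cast_sub (Nat.pow_le_pow_right Nat.card_pos hi), Nat.cast_pow, Nat.cast_pow]

theorem card_smallSubspaces_eq_numSubspaces (n b : ℕ) :
    (smallSubspaces F (Fin n → F) b).card = numSubspaces F n b := by
  rw [numSubspaces, smallSubspaces, ← Set.ncard_eq_toFinset_card]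
  congr! 4 with U
  rw [le_div_iff₀ two_pos, mul_comm, finrank_fin_fun]
  norm_cast

end Main

theorem theorem1p3 {F : Type*} [Field F] [Fintype F] (q : ℕ) (hq : Fintype.card F = q)
    (n : ℕ) (hn : 2 ≤ n) (b : ℕ) (hb : IsLeast {p : ℕ | p.Prime ∧ p ∣ n} b) :
    IsProperlyCoverable (Matrix (Fin n) (Fin n) F) ∧
    (coveringNumber (Matrix (Fin n) (Fin n) F) : ℚ) =
      1 / (b : ℚ) * ∏ i ∈ (Finset.Icc 1 (n - 1)).filter (fun i => ¬ b ∣ i),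
        ((q : ℚ) ^ n - (q : ℚ) ^ i) + (numSubspaces F n b : ℚ) := by
  have : NeZero n := ⟨by lia⟩
  have hb0 : (b : ℚ) ≠ 0 := Nat.cast_ne_zero.2 hb.1.1.ne_zero
  obtain ⟨K, _, _, _, rfl⟩ := exists_field_finrank_eq F hb.1.1.ne_zero
  let e : End F (Fin n → F) ≃+* Matrix (Fin n) (Fin n) F :=
    (Matrix.toLinAlgEquiv' (R := F) (n := Fin n)).symm.toRingEquiv
  rw [← finrank_fin_fun F (n := n)] at hb
  refine ⟨(isProperlyCoverable_end hb.1.1.one_lt hb.1.2).of_ringEquiv e, ?_⟩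
  have key := finrank_mul_coveringNumber_end hb
  rw [card_smallSubspaces_eq_numSubspaces, coveringNumber_congr e] at key
  have card_eq := cast_card_algHom_end_eq_prod hb.1.2
  rw [finrank_fin_fun, Nat.card_eq_fintype_card (α := F), hq] at card_eq
  rw [← card_eq]
  field_simp
  rw [mul_comm]
  exact_mod_cast key
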